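/- Let $G$ be a connected real Lie group of dimension $n$ with Lie algebra $\mathfrak g=T_eG$, and suppose that $G$ is nilpotent (i.e. $\mathfrak g$ is a nilpotent Lie algebra). Let $\omega$ be a nondegenerate skew-symmetric bilinear form on $\mathfrak g$ satisfying the 2-cocycle identity $\omega([u,v],w)+\omega([v,w],u)+\omega([w,u],v)=0$, and let $\omega^+$ be the left invariant symplectic form on $G$ with value $\omega$ at $e$. For $u\in\mathfrak g$ let $u^+$ denote the corresponding left invariant vector field, and let $\nabla$ be the left invariant linear connection on $G$ determined by $$\omega^+(\nabla_{u^+}v^+,w^+)=-\omega^+(v^+,[u^+,w^+])\qquad(u,v,w\in\mathfrak g).$$ An affine chart is a smooth chart $(x_1,\dots,x_n)$ of $G$ with connected domain whose coordinate vector fields $\partial/\partial x_i$ are $\nabla$-parallel. The affine charts cover $G$ (they form the affine structure associated to $(G,\omega^+)$), and the following holds. 1. For every $k\ge 0$, every left invariant field $T$ of $k$-vectors on $G$ is polynomial: in every affine chart, each coefficient $T(dx_{i_1},\dots,dx_{i_k})$ is a polynomial in $x_1,\dots,x_n$ on the domain of the chart. 2. In particular, every left invariant Poisson structure $\pi$ on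 $G$ is polynomial: the bivector field $\pi$ is polynomial in the sense of 1, and, equivalently, on the domain of every affine chart the bracket $\{f,h\}=\pi(df,dh)$ of two functions that are polynomial in the affine coordinates is again polynomial in the affine coordinates. -/

import Mathlib

open scoped Manifold ContDiff

noncomputable section

namespace SymplecticLie

instance instLEInftyMinSmoothness : ENat.LEInfty (minSmoothness ℝ 3) :=
  ⟨by simp only [minSmoothness_of_isRCLikeNormedField]; exact ENat.LEInfty.out⟩

/-- A scalar nondegenerate 2-cocycle `Ω` on the Lie algebra `T_1 G` of the `n`-dimensional Lie
group `G`. The pair `(G, Ω⁺)`, where `Ω⁺` is the left invariant 2-form on `G` with value `Ω` at the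
unit, is then a symplectic Lie group. -/
structure NondegCocycle (n : ℕ) (G : Type*) [TopologicalSpace G]
    [ChartedSpace (EuclideanSpace ℝ (Fin n)) G] [Group G] where
  /-- the underlying bilinear form -/
  form : LinearMap.BilinForm ℝ (GroupLieAlgebra (𝓡 n) G)
  alt : form.IsAlt
  nondeg : form.Nondegenerate
  cocycle : ∀ u v w : GroupLieAlgebra (𝓡 n) G,
    form ⁅u, v⁆ w + form ⁅v, w⁆ u + form ⁅w, u⁆ v = 0

variable {n : ℕ} {G : Type*} [TopologicalSpace G] [ChartedSpace (EuclideanSpace ℝ (Fin n)) G]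
  [Group G]

/-- The left trivialization `T_g G → T_1 G`, the inverse of the differential at `1` of the left
multiplication by `g`. -/
def leftTriv (g : G) (X : TangentSpace (𝓡 n) g) : GroupLieAlgebra (𝓡 n) G :=
  (mfderiv (𝓡 n) (𝓡 n) (g * ·) (1 : G)).inverse X

/-- The left invariant symplectic form `Ω⁺`. -/
def NondegCocycle.leftForm (Ω : NondegCocycle n G) (g : G) (X Y : TangentSpace (𝓡 n) g) : ℝ :=
  Ω.form (leftTriv g X) (leftTriv g Y)

/-- A vector field seen as a function with values in the Lie algebra, through left
trivialization. (`TangentSpace (𝓡 n) 1` is, by definition, a copy of the model space.) -/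
def leftComponents (Y : Π g : G, TangentSpace (𝓡 n) g) : G → EuclideanSpace ℝ (Fin n) :=
  fun g => leftTriv g (Y g)

section Lie

variable [LieGroup (𝓡 n) ∞ G]

/-- The product `u ⋆ v` on the Lie algebra determined by `Ω (u ⋆ v) w = - Ω v [u, w]`. -/
def NondegCocycle.prod (Ω : NondegCocycle n G) (u v : GroupLieAlgebra (𝓡 n) G) :
    GroupLieAlgebra (𝓡 n) G :=
  haveI : FiniteDimensional ℝ (GroupLieAlgebra (𝓡 n) G) :=
    inferInstanceAs (FiniteDimensional ℝ (EuclideanSpace ℝ (Fin n)))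
  (Ω.form.toDual Ω.nondeg).symm (-(Ω.form v ∘ₗ (LieAlgebra.ad ℝ (GroupLieAlgebra (𝓡 n) G) u)))

theorem NondegCocycle.form_prod (Ω : NondegCocycle n G) (u v w : GroupLieAlgebra (𝓡 n) G) :
    Ω.form (Ω.prod u v) w = - Ω.form v ⁅u, w⁆ := by
  have : FiniteDimensional ℝ (GroupLieAlgebra (𝓡 n) G) :=
    inferInstanceAs (FiniteDimensional ℝ (EuclideanSpace ℝ (Fin n)))
  simp [NondegCocycle.prod, LinearMap.BilinForm.apply_toDual_symm_apply]

/-- The covariant derivative `∇_X Y` at `g` of the vector field `Y` in the direction `X ∈ T_g G`,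
for the left invariant linear connection `∇` with `∇_{u⁺} v⁺ = (u ⋆ v)⁺` on left invariant fields:
in the left trivialization it is the derivative of the components of `Y`, plus the Christoffel
term `⋆`. It is characterized by `Ω⁺ (∇_{u⁺} v⁺, w⁺) = - Ω⁺ (v⁺, [u⁺, w⁺])`,
see `leftForm_nabla`. -/
def NondegCocycle.nabla (Ω : NondegCocycle n G) (Y : Π g : G, TangentSpace (𝓡 n) g) (g : G)
    (X : TangentSpace (𝓡 n) g) : TangentSpace (𝓡 n) g :=
  letI D : GroupLieAlgebra (𝓡 n) G := mvfderiv (𝓡 n) (leftComponents Y) g X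
  mulInvariantVectorField (D + Ω.prod (leftTriv g X) (leftTriv g (Y g))) g

theorem leftTriv_mulInvariantVectorField (v : GroupLieAlgebra (𝓡 n) G) (g : G) :
    leftTriv g (mulInvariantVectorField v g) = v := by
  have h := congrFun (mpullback_mulInvariantVectorField (I := 𝓡 n) g v) 1
  have h1 : mulInvariantVectorField (I := 𝓡 n) v (1 : G) = v := by
    have : ((1 : G) * ·) = id := by ext; simp
    rw [mulInvariantVectorField, this, mfderiv_id]
    rfl
  rw [h1, VectorField.mpullback_apply] at h
  have e : ∀ a : G, a = g → (mulInvariantVectorField v a : EuclideanSpace ℝ (Fin n)) =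
      (mulInvariantVectorField v g : EuclideanSpace ℝ (Fin n)) := by
    rintro _ rfl
    rfl
  exact (congrArg (mfderiv (𝓡 n) (𝓡 n) (g * ·) (1 : G)).inverse (e (g * 1) (mul_one g))).symm.trans h

theorem NondegCocycle.nabla_mulInvariantVectorField (Ω : NondegCocycle n G)
    (u v : GroupLieAlgebra (𝓡 n) G) (g : G) :
    Ω.nabla (mulInvariantVectorField v) g (mulInvariantVectorField u g) =
      mulInvariantVectorField (Ω.prod u v) g := by
  have h : leftComponents (mulInvariantVectorField v : Π g : G, TangentSpace (𝓡 n) g) =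
      fun _ => v := funext fun g => leftTriv_mulInvariantVectorField v g
  rw [NondegCocycle.nabla, h, leftTriv_mulInvariantVectorField, leftTriv_mulInvariantVectorField]
  have h0 : ∀ c : EuclideanSpace ℝ (Fin n), mvfderiv (𝓡 n) (fun _ : G => c) g = 0 := by
    intro c
    unfold mvfderiv
    rw [mfderiv_const]
    exact ContinuousLinearMap.comp_zero _
  have h1 : ∀ X : TangentSpace (𝓡 n) g, (mvfderiv (𝓡 n) (F := EuclideanSpace ℝ (Fin n))
      (fun _ : G => v) g) X = (0 : EuclideanSpace ℝ (Fin n)) :=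
    fun X => DFunLike.congr_fun (h0 v) X
  exact congrArg (fun z => mulInvariantVectorField z g)
    ((congrArg (fun z : GroupLieAlgebra (𝓡 n) G => z + Ω.prod u v) (h1 _)).trans (zero_add _))

theorem NondegCocycle.leftForm_nabla (Ω : NondegCocycle n G)
    (u v w : GroupLieAlgebra (𝓡 n) G) (g : G) :
    Ω.leftForm g (Ω.nabla (mulInvariantVectorField v) g (mulInvariantVectorField u g))
        (mulInvariantVectorField w g) =
      - Ω.leftForm g (mulInvariantVectorField v g)
        (VectorField.mlieBracket (𝓡 n) (mulInvariantVectorField u) (mulInvariantVectorField w) g)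
    := by
  rw [← mulInvariantVector_mlieBracket, nabla_mulInvariantVectorField, ← GroupLieAlgebra.bracket_def]
  simp only [leftForm, leftTriv_mulInvariantVectorField, form_prod]

/-- Affine charts of the affine structure associated to `(G, Ω⁺)`: smooth charts `(x₁, …, xₙ)` with
connected domain whose coordinate vector fields `∂/∂xᵢ` are parallel for `∇`. -/
structure NondegCocycle.IsAffineChart (Ω : NondegCocycle n G)
    (x : OpenPartialHomeomorph G (EuclideanSpace ℝ (Fin n))) : Prop where
  smooth : x ∈ IsManifold.maximalAtlas (𝓡 n) ∞ G
  connected : IsPreconnected x.source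
  parallel : ∀ i : Fin n, ∀ g ∈ x.source, ∀ X : TangentSpace (𝓡 n) g,
    Ω.nabla (VectorField.mpullback (𝓡 n) (𝓡 n) x
      (fun _ => (EuclideanSpace.single i 1 : EuclideanSpace ℝ (Fin n)))) g X = 0

end Lie

/-- On the domain of the chart `x`, the function `f` is a polynomial in the coordinates. -/
def IsPolynomialIn (x : OpenPartialHomeomorph G (EuclideanSpace ℝ (Fin n))) (f : G → ℝ) : Prop :=
  ∃ p : MvPolynomial (Fin n) ℝ, ∀ g ∈ x.source, f g = MvPolynomial.eval (fun i => x g i) p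

variable (n G) in
/-- Fields of `k`-vectors on `G`; a `k`-vector at `g` is seen as an alternating `k`-linear form on
the cotangent space at `g`. -/
abbrev MultivectorField (k : ℕ) : Type _ :=
  ∀ g : G, (TangentSpace (𝓡 n) g →L[ℝ] ℝ) [⋀^Fin k]→ₗ[ℝ] ℝ

/-- `T` is invariant under push-forward by all left multiplications. -/
def IsLeftInvariant {k : ℕ} (T : MultivectorField n G k) : Prop :=
  ∀ (h g : G) (α : Fin k → (TangentSpace (𝓡 n) (h * g) →L[ℝ] ℝ)),
    T (h * g) α = T g (fun i => (α i).comp (mfderiv (𝓡 n) (𝓡 n) (h * ·) g))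

/-- The bracket `{f, h} = π (df, dh)` of a bivector field. -/
def bracket (π : MultivectorField n G 2) (f h : G → ℝ) : G → ℝ :=
  fun g => π g ![mvfderiv (𝓡 n) f g, mvfderiv (𝓡 n) h g]

/-- Poisson structures: smooth bivector fields whose bracket satisfies the Jacobi identity. -/
structure IsPoisson (π : MultivectorField n G 2) : Prop where
  smooth : ∀ f h : G → ℝ, ContMDiff (𝓡 n) 𝓘(ℝ, ℝ) ∞ f → ContMDiff (𝓡 n) 𝓘(ℝ, ℝ) ∞ h →
    ContMDiff (𝓡 n) 𝓘(ℝ, ℝ) ∞ (bracket π f h)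
  jacobi : ∀ f₁ f₂ f₃ : G → ℝ, ContMDiff (𝓡 n) 𝓘(ℝ, ℝ) ∞ f₁ → ContMDiff (𝓡 n) 𝓘(ℝ, ℝ) ∞ f₂ →
    ContMDiff (𝓡 n) 𝓘(ℝ, ℝ) ∞ f₃ → ∀ g : G,
    bracket π f₁ (bracket π f₂ f₃) g + bracket π f₂ (bracket π f₃ f₁) g +
      bracket π f₃ (bracket π f₁ f₂) g = 0

section Lie

variable [LieGroup (𝓡 n) ∞ G]

/-- A field of `k`-vectors is polynomial if, in all affine charts, its coefficients
`T (dx_{i₁}, …, dx_{iₖ})` are polynomials in the affine coordinates. -/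
def NondegCocycle.IsPolynomial (Ω : NondegCocycle n G) {k : ℕ} (T : MultivectorField n G k) :
    Prop :=
  ∀ x : OpenPartialHomeomorph G (EuclideanSpace ℝ (Fin n)), Ω.IsAffineChart x →
    ∀ i : Fin k → Fin n,
      IsPolynomialIn x (fun g => T g (fun j => mvfderiv (𝓡 n) (fun h : G => x h (i j)) g))

/-- The bracket of `π` preserves the local polynomial functions, i.e. the functions that are
polynomial in the affine coordinates on the domain of an affine chart. -/
def NondegCocycle.IsPolynomialPoisson (Ω : NondegCocycle n G) (π : MultivectorField n G 2) :
    Prop :=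
  ∀ x : OpenPartialHomeomorph G (EuclideanSpace ℝ (Fin n)), Ω.IsAffineChart x →
    ∀ f h : G → ℝ, IsPolynomialIn x f → IsPolynomialIn x h → IsPolynomialIn x (bracket π f h)

end Lie

end SymplecticLie

end

/-! Fix an affine chart. Let `A z u` be the coordinate expression of `u⁺` at `z`, and let `w i` be
the vector field that is ω-dual to `dxᵢ`, read in the left trivialization: ω(u, w i) = dxᵢ(u⁺). The
formula ω(u ⋆ v, w) = -ω(v, [u, w]) turns parallelism of `dxᵢ` into the equation u⁺(w) = -[u, w],
which says that `w i` is a right invariant field (`isCoparallel_frame`). Conversely, the ω-dual of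
any right invariant field is a 1-form with constant coefficients (`exists_linear`).

Two facts follow. By the cocycle identity, the derivative of ω(w i, w j) is minus the ω-dual of the
right invariant field [w i, w j], so the entries of the Gram matrix ω(w i, w j) are affine functions
(`polyOn_om_frame`). In a fixed basis the matrix R of the `w i` satisfies R' = -ad(u) R, and `ad u`
has trace zero because it is nilpotent; hence det R, and with it the nonzero Gram determinant, is
constant (`gram_det_const`). The inverse Gram matrix is therefore polynomial. Since it expresses
∂/∂xᵢ through the right invariant fields, a function whose derivatives along these fields are
polynomial is itself polynomial (`polyOn_of_frame`).

The derivative of ω(u, w) along `w j` is -ω(u, [w j, w]), and [w j, w] is again right invariant and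
lies one step deeper in the lower central series. Descending induction makes every ω(u, w)
polynomial, in particular the coordinates ω(u, w i) of `u⁺` (`polyOn_apply`). A left invariant
multivector has constant coefficients in the frame of left invariant fields, so its affine
coefficients are polynomial; the Leibniz rule then handles Poisson brackets.

For the existence of affine charts the duality is run backwards. The ω-duals of a right invariant
frame are parallel 1-forms; they are closed because ∇ is torsion free, and their local primitives
are the coordinates. -/

namespace SymplecticLie

/-! ### Polynomial functions on subsets of a Euclidean space, and integration of polynomial
differentials. -/

section PolynomialFunctions

open MvPolynomial

variable {ι : Type*}

/-- The functions on `s` that are given by a polynomial in the coordinates. -/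
def PolyOn (s : Set (EuclideanSpace ℝ ι)) (f : EuclideanSpace ℝ ι → ℝ) : Prop :=
  ∃ p : MvPolynomial ι ℝ, ∀ z ∈ s, f z = eval (fun i => z i) p

variable {s : Set (EuclideanSpace ℝ ι)} {f g : EuclideanSpace ℝ ι → ℝ}

theorem PolyOn.congr (hf : PolyOn s f) (h : ∀ z ∈ s, g z = f z) : PolyOn s g :=
  let ⟨p, hp⟩ := hf
  ⟨p, fun z hz => (h z hz).trans (hp z hz)⟩

theorem polyOn_const (c : ℝ) : PolyOn s fun _ => c := ⟨C c, fun z _ => by simp⟩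

theorem polyOn_coord (i : ι) : PolyOn s fun z => z i := ⟨X i, fun z _ => by simp⟩

theorem PolyOn.add (hf : PolyOn s f) (hg : PolyOn s g) : PolyOn s fun z => f z + g z := by
  obtain ⟨p, hp⟩ := hf
  obtain ⟨q, hq⟩ := hg
  exact ⟨p + q, fun z hz => by simp [hp z hz, hq z hz]⟩

theorem PolyOn.mul (hf : PolyOn s f) (hg : PolyOn s g) : PolyOn s fun z => f z * g z := by
  obtain ⟨p, hp⟩ := hf
  obtain ⟨q, hq⟩ := hg
  exact ⟨p * q, fun z hz => by simp [hp z hz, hq z hz]⟩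

theorem PolyOn.sum {κ : Type*} {t : Finset κ} {F : κ → EuclideanSpace ℝ ι → ℝ}
    (h : ∀ k ∈ t, PolyOn s (F k)) : PolyOn s fun z => ∑ k ∈ t, F k z := by
  classical
  induction t using Finset.induction_on with
  | empty => simpa using polyOn_const 0
  | insert a t ha ih =>
    simp only [Finset.sum_insert ha]
    exact (h a (by simp)).add (ih fun k hk => h k (by simp [hk]))

theorem PolyOn.prod {κ : Type*} {t : Finset κ} {F : κ → EuclideanSpace ℝ ι → ℝ}
    (h : ∀ k ∈ t, PolyOn s (F k)) : PolyOn s fun z => ∏ k ∈ t, F k z := by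
  classical
  induction t using Finset.induction_on with
  | empty => simpa using polyOn_const 1
  | insert a t ha ih =>
    simp only [Finset.prod_insert ha]
    exact (h a (by simp)).mul (ih fun k hk => h k (by simp [hk]))

theorem euclidean_sum_single [Fintype ι] [DecidableEq ι] (v : EuclideanSpace ℝ ι) :
    v = ∑ i, v i • EuclideanSpace.single i (1 : ℝ) := by
  ext j
  simp [Pi.single_apply]

theorem clm_apply_eq_sum [Fintype ι] [DecidableEq ι] (l : EuclideanSpace ℝ ι →L[ℝ] ℝ)
    (v : EuclideanSpace ℝ ι) : l v = ∑ i, v i * l (EuclideanSpace.single i 1) := by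
  conv_lhs => rw [euclidean_sum_single v, map_sum]
  simp only [map_smul, smul_eq_mul]

theorem polyOn_clm [Fintype ι] [DecidableEq ι] (l : EuclideanSpace ℝ ι →L[ℝ] ℝ) :
    PolyOn s fun z => l z := by
  refine PolyOn.congr (f := fun z => ∑ i, z i * l (EuclideanSpace.single i 1)) ?_
    fun z _ => clm_apply_eq_sum l z
  exact PolyOn.sum fun i _ => (polyOn_coord i).mul (polyOn_const _)

/-- The differential of a polynomial function. -/
theorem hasFDerivAt_eval [Fintype ι] (p : MvPolynomial ι ℝ) (z : EuclideanSpace ℝ ι) :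
    HasFDerivAt (fun z : EuclideanSpace ℝ ι => eval (fun i => z i) p)
      (∑ i, eval (fun i => z i) (pderiv i p) • (EuclideanSpace.proj i : _ →L[ℝ] ℝ)) z := by
  classical
  induction p using MvPolynomial.induction_on with
  | C a => simpa using hasFDerivAt_const a z
  | add p q hp hq =>
    simpa [add_smul, Finset.sum_add_distrib] using hp.fun_add hq
  | mul_X p j hp =>
    have hj : HasFDerivAt (fun z : EuclideanSpace ℝ ι => z j)
      (EuclideanSpace.proj j : _ →L[ℝ] ℝ) z := (EuclideanSpace.proj j : _ →L[ℝ] ℝ).hasFDerivAt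
    have h := hp.mul hj
    simp only [map_mul, eval_X]
    refine h.congr_fderiv ?_
    simp only [Derivation.leibniz, pderiv_X, smul_eq_mul, map_add, map_mul, eval_X,
      add_smul, Finset.sum_add_distrib, Finset.smul_sum, smul_smul]
    congr 1
    rw [Finset.sum_eq_single j]
    · simp
    · intro b _ hb
      simp [hb.symm]
    · simp

/-- A neighbourhood contains a product of intervals, and a polynomial is determined by its values on
a product of infinite sets. -/
theorem eval_eq_of_eventuallyEq [Finite ι] {p q : MvPolynomial ι ℝ} {z₀ : EuclideanSpace ℝ ι}
    (h : ∀ᶠ z : EuclideanSpace ℝ ι in nhds z₀, eval (fun i => z i) p = eval (fun i => z i) q) :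
    p = q := by
  have : Fintype ι := Fintype.ofFinite ι
  have hc : Continuous fun x : ι → ℝ => (WithLp.toLp 2 x : EuclideanSpace ℝ ι) :=
    PiLp.continuous_toLp 2 _
  have h' : ∀ᶠ x : ι → ℝ in nhds (fun i => z₀ i), eval x p = eval x q :=
    (hc.tendsto fun i => z₀ i).eventually h
  obtain ⟨ε, hε, hb⟩ := Metric.eventually_nhds_iff_ball.1 h'
  refine MvPolynomial.funext_set (fun i => Metric.ball (z₀ i) ε) (fun i => ?_) fun x hx => hb x ?_
  · exact infinite_of_mem_nhds (z₀ i) (Metric.ball_mem_nhds _ hε)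
  · rw [ball_pi _ hε]
    exact hx

/-- Applied with `R` a polynomial ring, this integrates along a segment whose endpoint stays a
variable. -/
theorem exists_derivative_eq {R : Type*} [CommRing R] [Algebra ℚ R] (g : Polynomial R) :
    ∃ h : Polynomial R, Polynomial.derivative h = g := by
  induction g using Polynomial.induction_on' with
  | add p q hp hq =>
    obtain ⟨a, rfl⟩ := hp
    obtain ⟨b, rfl⟩ := hq
    exact ⟨a + b, by simp⟩
  | monomial n a =>
    refine ⟨Polynomial.monomial (n + 1) (((n + 1 : ℚ)⁻¹) • a), ?_⟩
    rw [Polynomial.derivative_monomial, Nat.add_sub_cancel]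
    have : ((n + 1 : ℚ)⁻¹ • a) * ((n + 1 : ℕ) : R) = a := by
      rw [mul_comm, ← nsmul_eq_mul, ← Nat.cast_smul_eq_nsmul ℚ, smul_smul]
      have : (n + 1 : ℚ) ≠ 0 := by positivity
      push_cast
      rw [mul_inv_cancel₀ this, one_smul]
    rw [this]

/-- Near each point, a function whose partial derivatives are polynomials is a polynomial. -/
theorem eventually_eq_eval_of_partials [Fintype ι] [DecidableEq ι]
    (hs : IsOpen s) {P : ι → MvPolynomial ι ℝ}
    (hf : ∀ z ∈ s, HasFDerivAt f
      (∑ i, eval (fun i => z i) (P i) • (EuclideanSpace.proj i : _ →L[ℝ] ℝ)) z)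
    {z₀ : EuclideanSpace ℝ ι} (hz₀ : z₀ ∈ s) :
    ∃ q : MvPolynomial ι ℝ, ∀ᶠ z in nhds z₀, f z = eval (fun i => z i) q := by
  -- The segment from `z₀` to the generic point `X`, as a polynomial in the time with coefficients
  -- in the coordinates. Below, `g` is the time derivative that `f` must have along it, and `h` is a
  -- primitive of `g`.
  let line : ι → Polynomial (MvPolynomial ι ℝ) := fun i =>
    Polynomial.C (C (z₀ i)) + Polynomial.X * Polynomial.C (X i - C (z₀ i))
  let g : Polynomial (MvPolynomial ι ℝ) :=
    ∑ i, aeval line (P i) * Polynomial.C (X i - C (z₀ i))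
  obtain ⟨h, hh⟩ := exists_derivative_eq g
  refine ⟨C (f z₀) + (h.eval 1 - h.eval 0), ?_⟩
  obtain ⟨ε, hε, hball⟩ := Metric.isOpen_iff.1 hs z₀ hz₀
  filter_upwards [Metric.ball_mem_nhds z₀ hε] with z hz
  let ev : MvPolynomial ι ℝ →+* ℝ := eval (fun i => z i)
  let c : ℝ → EuclideanSpace ℝ ι := fun t => z₀ + t • (z - z₀)
  have hc : ∀ t, HasDerivAt c (z - z₀) t := fun t => by
    have := ((hasDerivAt_id t).smul_const (z - z₀)).const_add z₀
    rwa [one_smul] at this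
  have hline : ∀ t : ℝ, ∀ i, (line i).eval₂ ev t = c t i := fun t i => by
    simp [line, Polynomial.eval₂_add, Polynomial.eval₂_mul, ev, c]
  have hg : ∀ t : ℝ, g.eval₂ ev t = ∑ i, eval (fun i => c t i) (P i) * (z i - z₀ i) := fun t => by
    have key : ∀ p : MvPolynomial ι ℝ,
        (aeval line p).eval₂ ev t = eval (fun i => c t i) p := by
      intro p
      induction p using MvPolynomial.induction_on with
      | C a => simp [MvPolynomial.algebraMap_eq, Polynomial.algebraMap_apply, ev]
      | add p q hp hq => simp [Polynomial.eval₂_add, hp, hq]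
      | mul_X p j hp => simp [Polynomial.eval₂_mul, hp, hline]
    simp only [g, Polynomial.eval₂_finsetSum, Polynomial.eval₂_mul, key, Polynomial.eval₂_C]
    simp [ev]
  have hmem : ∀ t ∈ Set.Icc (0 : ℝ) 1, c t ∈ s := fun t ht => hball <|
    (convex_ball z₀ ε).add_smul_sub_mem (Metric.mem_ball_self hε) hz ht
  have hd : ∀ t ∈ Set.Icc (0 : ℝ) 1,
      HasDerivAt (fun t => f (c t) - (h.map ev).eval t) 0 t := fun t ht => by
    have h1 := (hf _ (hmem t ht)).comp_hasDerivAt t (hc t)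
    have h2 := (h.map ev).hasDerivAt t
    rw [Polynomial.derivative_map, hh, Polynomial.eval_map, hg] at h2
    have h3 := h1.sub h2
    refine h3.congr_deriv ?_
    simp
  have hconst := (convex_Icc (0 : ℝ) 1).is_const_of_fderivWithin_eq_zero (𝕜 := ℝ)
    (f := fun t => f (c t) - (h.map ev).eval t)
    (fun t ht => (hd t ht).differentiableAt.differentiableWithinAt)
    (fun t ht => by
      have := (hd t ht).hasFDerivAt.hasFDerivWithinAt (s := Set.Icc (0 : ℝ) 1)
      rw [this.fderivWithin (uniqueDiffOn_Icc one_pos t ht)]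
      ext
      simp)
    (x := 0) (y := 1) (by simp) (by simp)
  have e0 : (h.map ev).eval 0 = ev (h.eval 0) := by
    simp
  have e1 : (h.map ev).eval 1 = ev (h.eval 1) := by
    simp
  simp only [c, zero_smul, add_zero, one_smul, add_sub_cancel, e0, e1] at hconst
  simp only [map_add, eval_C, map_sub]
  linarith

/-- On a connected open set, a function whose partial derivatives are polynomials is a
polynomial. -/
theorem polyOn_of_partials [Fintype ι] [DecidableEq ι] (hs : IsOpen s) (hs' : IsPreconnected s)
    (hf : DifferentiableOn ℝ f s)
    (hP : ∀ i, PolyOn s fun z => fderiv ℝ f z (EuclideanSpace.single i 1)) : PolyOn s f := by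
  choose P hP using hP
  have hf' : ∀ z ∈ s, HasFDerivAt f
      (∑ i, eval (fun i => z i) (P i) • (EuclideanSpace.proj i : _ →L[ℝ] ℝ)) z := by
    intro z hz
    refine ((hf z hz).differentiableAt (hs.mem_nhds hz)).hasFDerivAt.congr_fderiv ?_
    ext v
    rw [clm_apply_eq_sum]
    simp [hP _ z hz, mul_comm]
  rcases s.eq_empty_or_nonempty with rfl | ⟨z₀, hz₀⟩
  · exact ⟨0, by simp⟩
  obtain ⟨q, hq⟩ := eventually_eq_eval_of_partials hs hf' hz₀
  -- Agreement near `z₀` forces an identity of polynomials, so `f - q` has zero differential on all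
  -- of `s`, not only near `z₀`.
  have hpd : ∀ i, pderiv i q = P i := fun i => by
    refine eval_eq_of_eventuallyEq (z₀ := z₀) ?_
    filter_upwards [hq.eventually_nhds, hs.mem_nhds hz₀] with z hz hzs
    have h1 := (hf' z hzs).unique ((hasFDerivAt_eval q z).congr_of_eventuallyEq hz)
    have h2 := DFunLike.congr_fun h1 (EuclideanSpace.single i 1)
    simpa [PiLp.single_apply] using h2.symm
  have hd : ∀ z ∈ s, HasFDerivAt (fun z => f z - eval (fun i => z i) q) 0 z := fun z hz => by
    have := (hf' z hz).fun_sub (hasFDerivAt_eval q z)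
    simpa [hpd] using this
  refine ⟨q, fun z hz => ?_⟩
  have := hs.is_const_of_fderiv_eq_zero (𝕜 := ℝ) hs'
    (fun z hz => (hd z hz).differentiableAt.differentiableWithinAt)
    (fun z hz => (hd z hz).fderiv) hz hz₀
  have h0 := hq.self_of_nhds
  simp only [h0, sub_self] at this
  linarith

end PolynomialFunctions

end SymplecticLie

/-! ### Abstract symplectic Lie algebras: filtrations, Liouville's formula, parallel and coparallel
fields. -/

noncomputable section

namespace SymplecticLie

/-- A symplectic Lie algebra structure on a normed space, with the left symmetric product. -/
structure SymplecticAlgebra (L : Type*) [NormedAddCommGroup L] [NormedSpace ℝ L] where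
  br : L →L[ℝ] L →L[ℝ] L
  om : L →L[ℝ] L →L[ℝ] ℝ
  prod : L → L → L
  sharp : (L →L[ℝ] ℝ) →L[ℝ] L
  om_sharp : ∀ l u, om u (sharp l) = l u
  om_neg : ∀ u v, om u v = -om v u
  ext_om : ∀ v w, (∀ u, om u v = om u w) → v = w
  br_neg : ∀ u v, br u v = -br v u
  jacobi : ∀ u v w, br u (br v w) = br (br u v) w + br v (br u w)
  cocycle : ∀ u v w, om (br u v) w + om (br v w) u + om (br w u) v = 0
  om_prod : ∀ u v w, om (prod u v) w = -om v (br u w)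

/-- A filtration witnessing nilpotency. -/
structure SymplecticAlgebra.Flag {L : Type*} [NormedAddCommGroup L] [NormedSpace ℝ L]
    (𝔰 : SymplecticAlgebra L) (N : ℕ) where
  space : ℕ → Set L
  mem_zero : ∀ u, u ∈ space 0
  br_mem : ∀ k u v, v ∈ space k → 𝔰.br u v ∈ space (k + 1)
  eq_zero : ∀ u ∈ space N, u = 0

section Determinant

variable {E : Type*} [NormedAddCommGroup E] [NormedSpace ℝ E] {m : Type*} [Fintype m]
  [DecidableEq m]

/-- Liouville's formula: if `R' = N R` in some direction, then `(det R)' = tr N · det R`. -/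
theorem hasFDerivAt_det {R : E → Matrix m m ℝ} {R' : m → m → E →L[ℝ] ℝ} {z e : E}
    (hR : ∀ i j, HasFDerivAt (fun z => R z i j) (R' i j) z) {N : Matrix m m ℝ}
    (hN : ∀ i j, R' i j e = (N * R z) i j) :
    DifferentiableAt ℝ (fun z => (R z).det) z ∧
      fderiv ℝ (fun z => (R z).det) z e = N.trace * (R z).det := by
  have h1 : HasFDerivAt (fun z => (R z).det)
      (∑ σ : Equiv.Perm m, (Equiv.Perm.sign σ : ℤ) •
        ∑ i, (∏ j ∈ Finset.univ.erase i, R z (σ j) j) • R' (σ i) i) z := by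
    simp only [Matrix.det_apply]
    refine HasFDerivAt.fun_sum fun σ _ => ?_
    exact (HasFDerivAt.finsetProd (u := Finset.univ)
      fun i _ => hR (σ i) i).const_smul (Equiv.Perm.sign σ : ℤ)
  refine ⟨h1.differentiableAt, ?_⟩
  -- By Cramer's rule the sum of the determinants with one column of `R` replaced by that of `N * R`
  -- is tr(adj R · N R) = tr N · det R.
  have h2 : N.trace * (R z).det = ∑ i, ((R z).updateCol i fun k => (N * R z) k i).det := by
    simp only [← Matrix.cramer_apply, Matrix.cramer_eq_adjugate_mulVec]
    have : ∀ i, ((R z).adjugate.mulVec fun k => (N * R z) k i) i =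
      ((R z).adjugate * (N * R z)) i i := fun i => rfl
    simp only [this]
    change _ = Matrix.trace _
    rw [Matrix.trace_mul_comm, Matrix.mul_assoc, Matrix.mul_adjugate]
    simp [mul_comm]
  rw [h1.fderiv, h2]
  simp only [Matrix.det_apply, sum_apply, smul_apply]
  rw [Finset.sum_comm]
  refine Finset.sum_congr rfl fun σ _ => ?_
  rw [Finset.smul_sum]
  refine Finset.sum_congr rfl fun i _ => ?_
  rw [← Finset.mul_prod_erase _ _ (Finset.mem_univ i)]
  have : ∏ x ∈ Finset.univ.erase i, (R z).updateCol i (fun k => (N * R z) k i) (σ x) x =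
      ∏ x ∈ Finset.univ.erase i, R z (σ x) x :=
    Finset.prod_congr rfl fun x hx => by
      rw [Matrix.updateCol_ne (Finset.ne_of_mem_erase hx)]
  rw [this, Matrix.updateCol_self, hN, smul_eq_mul, mul_comm]
  rfl

end Determinant

section AffineChart

variable {L : Type*} [NormedAddCommGroup L] [NormedSpace ℝ L]
  {ι : Type*} [Fintype ι] (𝔰 : SymplecticAlgebra L)
  {V : Set (EuclideanSpace ℝ ι)} {A : EuclideanSpace ℝ ι → L →L[ℝ] EuclideanSpace ℝ ι}

/-- The vectors whose `om`-duals are the differentials of the coordinates. -/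
def SymplecticAlgebra.frame {ι : Type*} (A : EuclideanSpace ℝ ι → L →L[ℝ] EuclideanSpace ℝ ι)
    (i : ι) (z : EuclideanSpace ℝ ι) : L :=
  𝔰.sharp ((EuclideanSpace.proj i : EuclideanSpace ℝ ι →L[ℝ] ℝ).comp (A z))

theorem SymplecticAlgebra.om_frame {ι : Type*}
    (A : EuclideanSpace ℝ ι → L →L[ℝ] EuclideanSpace ℝ ι) (i : ι) (z : EuclideanSpace ℝ ι)
    (u : L) : 𝔰.om u (𝔰.frame A i z) = A z u i := by
  simp [SymplecticAlgebra.frame, 𝔰.om_sharp]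

/-- The map `A`, giving left invariant fields in some coordinates, comes from affine
coordinates. -/
structure SymplecticAlgebra.IsParallel (V : Set (EuclideanSpace ℝ ι))
    (A : EuclideanSpace ℝ ι → L →L[ℝ] EuclideanSpace ℝ ι) : Prop where
  diff : DifferentiableOn ℝ A V
  invertible : ∀ z ∈ V, (A z).IsInvertible
  fderiv_apply : ∀ z ∈ V, ∀ u v, fderiv ℝ A z (A z u) v = A z (𝔰.prod u v)

/-- The `w` such that `wᵃ` are right invariant fields, in the left trivialization. -/
structure SymplecticAlgebra.IsCoparallel (V : Set (EuclideanSpace ℝ ι))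
    (A : EuclideanSpace ℝ ι → L →L[ℝ] EuclideanSpace ℝ ι) (w : EuclideanSpace ℝ ι → L) :
    Prop where
  diff : DifferentiableOn ℝ w V
  fderiv_apply : ∀ z ∈ V, ∀ u, fderiv ℝ w z (A z u) = -𝔰.br u (w z)

variable {𝔰}

theorem SymplecticAlgebra.om_br_left (u v w : L) : 𝔰.om (𝔰.br u v) w = 𝔰.om w (𝔰.br v u) := by
  rw [𝔰.om_neg, 𝔰.br_neg, map_neg, neg_neg]

namespace SymplecticAlgebra.IsCoparallel

/-- By the Jacobi identity `-ad u` is a derivation, so the bracket of two solutions of w' = -[u, w]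
is a solution. -/
theorem bracket (hV : IsOpen V) {v w : EuclideanSpace ℝ ι → L} (hv : 𝔰.IsCoparallel V A v)
    (hw : 𝔰.IsCoparallel V A w) : 𝔰.IsCoparallel V A fun z => 𝔰.br (v z) (w z) := by
  have h : ∀ z ∈ V, HasFDerivAt (fun z => 𝔰.br (v z) (w z)) _ z := fun z hz =>
    𝔰.br.hasFDerivAt_of_bilinear
      ((hv.diff z hz).differentiableAt (hV.mem_nhds hz)).hasFDerivAt
      ((hw.diff z hz).differentiableAt (hV.mem_nhds hz)).hasFDerivAt
  refine ⟨fun z hz => (h z hz).differentiableAt.differentiableWithinAt, fun z hz u => ?_⟩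
  rw [(h z hz).fderiv]
  simp [hv.fderiv_apply z hz, hw.fderiv_apply z hz, 𝔰.jacobi u]

/-- The equation of `w` is adjoint to that of `A` through `om_prod`, so the 1-form ω-dual to `w` is
parallel, and parallel forms have constant coefficients in affine coordinates. -/
theorem exists_linear [FiniteDimensional ℝ L] (hV : IsOpen V) (hV' : IsPreconnected V)
    (hA : 𝔰.IsParallel V A)
    {w : EuclideanSpace ℝ ι → L} (hw : 𝔰.IsCoparallel V A w) :
    ∃ l : EuclideanSpace ℝ ι →L[ℝ] ℝ, ∀ z ∈ V, ∀ u, 𝔰.om u (w z) = l (A z u) := by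
  let G : EuclideanSpace ℝ ι → EuclideanSpace ℝ ι →L[ℝ] ℝ := fun z =>
    (𝔰.om.flip (w z)).comp (A z).inverse
  have : CompleteSpace L := FiniteDimensional.complete ℝ L
  have hinv : ∀ z ∈ V, DifferentiableAt ℝ (fun z => (A z).inverse) z := fun z hz =>
    ((hA.invertible z hz).contDiffAt_map_inverse (n := 1)).differentiableAt one_ne_zero |>.comp z
      ((hA.diff z hz).differentiableAt (hV.mem_nhds hz))
  have hw' : ∀ z ∈ V, DifferentiableAt ℝ w z := fun z hz =>
    (hw.diff z hz).differentiableAt (hV.mem_nhds hz)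
  have hA' : ∀ z ∈ V, DifferentiableAt ℝ A z := fun z hz =>
    (hA.diff z hz).differentiableAt (hV.mem_nhds hz)
  have hG : ∀ z ∈ V, DifferentiableAt ℝ G z := fun z hz =>
    (𝔰.om.flip.differentiableAt.comp z (hw' z hz)).clm_comp (hinv z hz)
  have hGA : ∀ z ∈ V, ∀ v, G z (A z v) = 𝔰.om v (w z) := fun z hz v => by
    simp [G, (hA.invertible z hz).inverse_apply_self]
  -- Differentiating `G z (A z v) = om v (w z)` along `A z u` produces `om (u ⋆ v) w` on the left
  -- and `-om v [u, w]` on the right; these agree, leaving zero for the derivative of `G`.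
  have hd : ∀ z ∈ V, fderiv ℝ G z = 0 := fun z hz => by
    have key : ∀ u v, fderiv ℝ G z (A z u) (A z v) = 0 := fun u v => by
      have h1 := ((hG z hz).hasFDerivAt.clm_apply
        ((hA' z hz).hasFDerivAt.clm_apply (hasFDerivAt_const v z))).fderiv
      have h2 := ((𝔰.om v).hasFDerivAt.comp z (hw' z hz).hasFDerivAt).fderiv
      have h3 : (fun z => G z (A z v)) =ᶠ[nhds z] (𝔰.om v) ∘ w := by
        filter_upwards [hV.mem_nhds hz] with y hy using hGA y hy v
      rw [h3.fderiv_eq, h2] at h1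
      have h4 := DFunLike.congr_fun h1 (A z u)
      simp only [ContinuousLinearMap.comp_apply, hw.fderiv_apply z hz, map_neg,
        add_apply, ContinuousLinearMap.flip_apply,
        hA.fderiv_apply z hz] at h4
      have h5 := hGA z hz (𝔰.prod u v)
      rw [𝔰.om_prod] at h5
      simp only [zero_apply, map_zero, zero_add, h5] at h4
      linarith
    obtain ⟨e, he⟩ := hA.invertible z hz
    ext x y
    have := key (e.symm x) (e.symm y)
    rw [← he] at this
    simpa using this
  rcases V.eq_empty_or_nonempty with rfl | ⟨z₀, hz₀⟩
  · exact ⟨0, by simp⟩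
  refine ⟨G z₀, fun z hz u => ?_⟩
  rw [← hGA z hz u, hV.is_const_of_fderiv_eq_zero (𝕜 := ℝ) hV'
    (fun z hz => (hG z hz).differentiableWithinAt) (fun z hz => hd z hz) hz hz₀]

end SymplecticAlgebra.IsCoparallel

namespace SymplecticAlgebra.IsParallel

/-- The coordinate differentials are parallel, and `om_prod` moves the product `u ⋆ v` from the
argument of the form to a bracket on its ω-dual. -/
theorem isCoparallel_frame (hV : IsOpen V) (hA : 𝔰.IsParallel V A) (i : ι) :
    𝔰.IsCoparallel V A (𝔰.frame A i) := by
  have hA' : ∀ z ∈ V, DifferentiableAt ℝ A z := fun z hz =>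
    (hA.diff z hz).differentiableAt (hV.mem_nhds hz)
  have hd : ∀ z ∈ V, DifferentiableAt ℝ (𝔰.frame A i) z := fun z hz =>
    𝔰.sharp.differentiableAt.comp z ((differentiableAt_const _).clm_comp (hA' z hz))
  refine ⟨fun z hz => (hd z hz).differentiableWithinAt, fun z hz u => ?_⟩
  refine 𝔰.ext_om _ _ fun v => ?_
  have h1 := ((𝔰.om v).hasFDerivAt.comp z (hd z hz).hasFDerivAt).fderiv
  have h2 : (𝔰.om v) ∘ (𝔰.frame A i) = fun z => (EuclideanSpace.proj i : _ →L[ℝ] ℝ) (A z v) :=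
    funext fun z => 𝔰.om_frame A i z v
  have h3 := ((EuclideanSpace.proj i : EuclideanSpace ℝ ι →L[ℝ] ℝ).hasFDerivAt.comp z
    ((hA' z hz).hasFDerivAt.clm_apply (hasFDerivAt_const v z))).fderiv
  rw [h2] at h1
  have h4 := DFunLike.congr_fun (h1.symm.trans h3) (A z u)
  simp only [ContinuousLinearMap.comp_apply, add_apply,
    ContinuousLinearMap.flip_apply, hA.fderiv_apply z hz] at h4
  rw [h4, map_neg, ← 𝔰.om_prod, 𝔰.om_frame]
  simp

/-- By the cocycle identity the derivative of this function along `u⁺` is -ω(u, [w i, w j]). The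
bracket is coparallel, so this is a constant linear form `-l`, and the function is affine. -/
theorem polyOn_om_frame [FiniteDimensional ℝ L] [DecidableEq ι] (hV : IsOpen V)
    (hV' : IsPreconnected V) (hA : 𝔰.IsParallel V A) (i j : ι) :
    PolyOn V fun z => 𝔰.om (𝔰.frame A i z) (𝔰.frame A j z) := by
  have hi := hA.isCoparallel_frame hV i
  have hj := hA.isCoparallel_frame hV j
  obtain ⟨l, hl⟩ := (hi.bracket hV hj).exists_linear hV hV' hA
  have h : ∀ z ∈ V, HasFDerivAt
      (fun z : EuclideanSpace ℝ ι => 𝔰.om (𝔰.frame A i z) (𝔰.frame A j z) + l z)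
      (0 : EuclideanSpace ℝ ι →L[ℝ] ℝ) z := by
    intro z hz
    have h0 := (𝔰.om.hasFDerivAt_of_bilinear
      ((hi.diff z hz).differentiableAt (hV.mem_nhds hz)).hasFDerivAt
      ((hj.diff z hz).differentiableAt (hV.mem_nhds hz)).hasFDerivAt).fun_add
      (l.hasFDerivAt (x := z))
    refine h0.congr_fderiv ?_
    obtain ⟨e, he⟩ := hA.invertible z hz
    ext x
    obtain ⟨u, rfl⟩ : ∃ u, A z u = x := ⟨e.symm x, by rw [← he]; simp⟩
    have hc := 𝔰.cocycle u (𝔰.frame A i z) (𝔰.frame A j z)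
    have h5 : 𝔰.om u (𝔰.br (𝔰.frame A i z) (𝔰.frame A j z)) = l (A z u) := hl z hz u
    rw [𝔰.om_neg] at h5
    have h6 : 𝔰.om (𝔰.frame A i z) (𝔰.br u (𝔰.frame A j z)) =
        𝔰.om (𝔰.br (𝔰.frame A j z) u) (𝔰.frame A i z) := (𝔰.om_br_left _ _ _).symm
    simp only [add_apply, ContinuousLinearMap.precompR_apply,
      ContinuousLinearMap.precompL_apply, ContinuousLinearMap.compL_apply,
      ContinuousLinearMap.comp_apply, hi.fderiv_apply z hz, hj.fderiv_apply z hz, map_neg,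
      neg_apply, zero_apply, ← h5, h6]
    linarith
  rcases V.eq_empty_or_nonempty with rfl | ⟨z₀, hz₀⟩
  · exact ⟨0, by simp⟩
  refine ((polyOn_const (𝔰.om (𝔰.frame A i z₀) (𝔰.frame A j z₀) + l z₀)).add
    (polyOn_clm (-l))).congr fun z hz => ?_
  have := hV.is_const_of_fderiv_eq_zero (𝕜 := ℝ) hV'
    (fun z hz => (h z hz).differentiableAt.differentiableWithinAt)
    (fun z hz => (h z hz).fderiv) hz hz₀
  simp only [← this, neg_apply]
  ring

end SymplecticAlgebra.IsParallel

end AffineChart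

end SymplecticLie

end

/-! ### Nilpotency: constant Gram determinant and polynomial left invariant fields. -/

noncomputable section

namespace SymplecticLie

variable {L : Type*} [NormedAddCommGroup L] [NormedSpace ℝ L] {𝔰 : SymplecticAlgebra L}

/-- Each application of `ad u` goes one step down the filtration, so its `N`-th power vanishes. -/
theorem SymplecticAlgebra.Flag.trace_br {N : ℕ} (F : 𝔰.Flag N) (u : L) :
    LinearMap.trace ℝ L (𝔰.br u : L →ₗ[ℝ] L) = 0 := by
  refine (LinearMap.isNilpotent_trace_of_isNilpotent ⟨N, ?_⟩).eq_zero
  have h : ∀ k v, ((𝔰.br u : L →ₗ[ℝ] L) ^ k) v ∈ F.space k := fun k => by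
    induction k with
    | zero => exact fun v => F.mem_zero _
    | succ k ih =>
      intro v
      rw [pow_succ']
      exact F.br_mem k u _ (ih v)
  ext v
  exact F.eq_zero _ (h N v)

/-- The Gram matrix of the coparallel frame. -/
def SymplecticAlgebra.gram (𝔰 : SymplecticAlgebra L) {ι : Type*}
    (A : EuclideanSpace ℝ ι → L →L[ℝ] EuclideanSpace ℝ ι) (z : EuclideanSpace ℝ ι) :
    Matrix ι ι ℝ :=
  Matrix.of fun i j => 𝔰.om (𝔰.frame A i z) (𝔰.frame A j z)

theorem SymplecticAlgebra.gram_apply {ι : Type*}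
    (A : EuclideanSpace ℝ ι → L →L[ℝ] EuclideanSpace ℝ ι) (z : EuclideanSpace ℝ ι) (i j : ι) :
    𝔰.gram A z i j = 𝔰.om (𝔰.frame A i z) (𝔰.frame A j z) := rfl

variable [FiniteDimensional ℝ L]
  {ι : Type*} [Fintype ι] [DecidableEq ι]
  {V : Set (EuclideanSpace ℝ ι)} {A : EuclideanSpace ℝ ι → L →L[ℝ] EuclideanSpace ℝ ι}

namespace SymplecticAlgebra.IsParallel

omit [FiniteDimensional ℝ L] in
-- If `c` is in the kernel, all coordinates of `A z (∑ cⱼ wⱼ)` vanish, hence `∑ cⱼ wⱼ = 0`; pairing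
-- with the vector that `A z` sends to `e_k` gives `c k = 0`.
theorem gram_det_ne_zero (hA : 𝔰.IsParallel V A) {z : EuclideanSpace ℝ ι} (hz : z ∈ V) :
    (𝔰.gram A z).det ≠ 0 := by
  obtain ⟨e, he⟩ := hA.invertible z hz
  intro h0
  obtain ⟨c, hc, hc0⟩ := Matrix.exists_mulVec_eq_zero_iff.2 h0
  refine hc (funext fun k => ?_)
  have h1 : ∀ u, 𝔰.om u (∑ j, c j • 𝔰.frame A j z) = ∑ j, c j * A z u j := fun u => by
    simp [𝔰.om_frame]
  have h2 : A z (∑ j, c j • 𝔰.frame A j z) = 0 := by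
    ext i
    have h3 := congrFun hc0 i
    rw [← 𝔰.om_frame, 𝔰.om_neg, map_sum]
    simp only [Matrix.mulVec, dotProduct, 𝔰.gram_apply A, Pi.zero_apply] at h3
    simpa [mul_comm] using h3
  have h4 : ∑ j, c j • 𝔰.frame A j z = 0 := by
    rw [← he] at h2
    exact e.map_eq_zero_iff.1 h2
  have h5 := h1 (e.symm (EuclideanSpace.single k 1))
  rw [h4, ← he] at h5
  simpa [Pi.single_apply] using h5.symm

/-- In a fixed basis the Gram matrix is Rᵀ J R with `J` constant and R' = -ad(u) R, so Liouville's
formula and the vanishing trace of `ad u` make det R constant. -/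
theorem gram_det_const (hV : IsOpen V) (hV' : IsPreconnected V) (hA : 𝔰.IsParallel V A) {N : ℕ}
    (F : 𝔰.Flag N) : ∃ d : ℝ, d ≠ 0 ∧ ∀ z ∈ V, (𝔰.gram A z).det = d := by
  rcases V.eq_empty_or_nonempty with rfl | ⟨z₀, hz₀⟩
  · exact ⟨1, by simp⟩
  refine ⟨_, hA.gram_det_ne_zero hz₀, fun z hz => ?_⟩
  -- Any basis of `L` indexed by `ι` would do; invertibility at `z₀` provides one.
  obtain ⟨κ, -⟩ := hA.invertible z₀ hz₀
  let b : Module.Basis ι ℝ L := (EuclideanSpace.basisFun ι ℝ).toBasis.map κ.symm.toLinearEquiv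
  let R : EuclideanSpace ℝ ι → Matrix ι ι ℝ := fun z =>
    Matrix.of fun k i => b.repr (𝔰.frame A i z) k
  let J : Matrix ι ι ℝ := Matrix.of fun k l => 𝔰.om (b k) (b l)
  have hM : ∀ z, 𝔰.gram A z = (R z).transpose * J * R z := fun z => by
    ext i j
    rw [𝔰.gram_apply A]
    conv_lhs => rw [← b.sum_repr (𝔰.frame A i z), ← b.sum_repr (𝔰.frame A j z)]
    simp only [map_sum, map_smul, sum_apply, smul_apply, smul_eq_mul, Matrix.mul_apply,
      Matrix.transpose_apply, R, J, Matrix.of_apply, Finset.sum_mul, Finset.mul_sum]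
    refine Finset.sum_congr rfl fun k _ => Finset.sum_congr rfl fun l _ => by ring
  have hdet : ∀ z, (𝔰.gram A z).det = (R z).det * J.det * (R z).det := fun z => by
    rw [hM, Matrix.det_mul, Matrix.det_mul, Matrix.det_transpose]
  let coord : ι → L →L[ℝ] ℝ := fun k => LinearMap.toContinuousLinearMap (b.coord k)
  have key : ∀ z ∈ V, ∀ u, DifferentiableAt ℝ (fun z => (R z).det) z ∧
      fderiv ℝ (fun z => (R z).det) z (A z u) = 0 := fun z hz u => by
    have h := hasFDerivAt_det (R := R) (z := z) (e := A z u)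
      (R' := fun k i => (coord k).comp (fderiv ℝ (𝔰.frame A i) z))
      (fun k i => (coord k).hasFDerivAt.comp z
        ((((hA.isCoparallel_frame hV i).diff z hz).differentiableAt (hV.mem_nhds hz)).hasFDerivAt))
      (N := -LinearMap.toMatrix b b (𝔰.br u : L →ₗ[ℝ] L)) (fun k i => by
        rw [ContinuousLinearMap.comp_apply, (hA.isCoparallel_frame hV i).fderiv_apply z hz,
          Matrix.neg_mul, Matrix.neg_apply, map_neg]
        have := congrFun (LinearMap.toMatrix_mulVec_repr b b (𝔰.br u : L →ₗ[ℝ] L)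
          (𝔰.frame A i z)) k
        exact congrArg Neg.neg this.symm)
    refine ⟨h.1, h.2.trans ?_⟩
    rw [Matrix.trace_neg, ← LinearMap.trace_eq_matrix_trace ℝ b, F.trace_br]
    simp
  have hconst := hV.is_const_of_fderiv_eq_zero (𝕜 := ℝ) hV' (f := fun z => (R z).det)
    (fun z hz => (key z hz 0).1.differentiableWithinAt)
    (fun z hz => by
      obtain ⟨e, he⟩ := hA.invertible z hz
      ext x
      have := (key z hz (e.symm x)).2
      rw [← he] at this
      simpa using this) hz hz₀
  rw [hdet, hdet, hconst]

/-- On a set where the Gram matrix is invertible with constant determinant, a function whose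
derivatives along the frame are polynomial is polynomial. -/
theorem polyOn_of_frame (hV : IsOpen V) (hV' : IsPreconnected V) (hA : 𝔰.IsParallel V A) {N : ℕ}
    (F : 𝔰.Flag N) {f : EuclideanSpace ℝ ι → ℝ} (hf : DifferentiableOn ℝ f V)
    (h : ∀ k, PolyOn V fun z => fderiv ℝ f z (A z (𝔰.frame A k z))) : PolyOn V f := by
  obtain ⟨d, hd, hdet⟩ := hA.gram_det_const hV hV' F
  choose P hP using fun i j => hA.polyOn_om_frame hV hV' i j
  let Q : Matrix ι ι (MvPolynomial ι ℝ) := Matrix.of P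
  -- The inverse Gram matrix is `d⁻¹` times the adjugate, whose entries are polynomials in the
  -- polynomial Gram entries.
  have hadj : ∀ i j, PolyOn V fun z => (𝔰.gram A z).adjugate i j := fun i j => by
    refine ⟨Q.adjugate i j, fun z hz => ?_⟩
    have : 𝔰.gram A z = (MvPolynomial.eval fun i => z i).mapMatrix Q := by
      ext k l
      exact hP k l z hz
    change (𝔰.gram A z).adjugate i j = _
    rw [this, ← RingHom.map_adjugate]
    rfl
  refine polyOn_of_partials hV hV' hf fun i => ?_
  refine PolyOn.congr (f := fun z => d⁻¹ * ∑ k, (𝔰.gram A z).adjugate i k *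
    fderiv ℝ f z (A z (𝔰.frame A k z))) ((polyOn_const _).mul (.sum fun k _ => (hadj i k).mul (h k)))
    fun z hz => ?_
  -- The `i`-th coordinate of the field `A z (w k)` is ω(w k, w i), so the Gram matrix carries the
  -- partial derivatives to the derivatives along the frame.
  have h1 : (fun k => fderiv ℝ f z (A z (𝔰.frame A k z))) = (𝔰.gram A z).mulVec
      (fun i => fderiv ℝ f z (EuclideanSpace.single i 1)) := by
    ext k
    rw [clm_apply_eq_sum]
    simp only [Matrix.mulVec, dotProduct, 𝔰.gram_apply A, 𝔰.om_frame]
  have h2 := congrArg (fun w => (𝔰.gram A z).adjugate.mulVec w i) h1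
  simp only [Matrix.mulVec_mulVec, Matrix.adjugate_mul, hdet z hz, Matrix.smul_mulVec,
    Matrix.one_mulVec, Pi.smul_apply, smul_eq_mul] at h2
  rw [eq_inv_mul_iff_mul_eq₀ hd, ← h2]
  rfl

/-- In affine coordinates, the left invariant fields of a nilpotent group are polynomial. -/
theorem polyOn_apply (hV : IsOpen V) (hV' : IsPreconnected V) (hA : 𝔰.IsParallel V A) {N : ℕ}
    (F : 𝔰.Flag N) (u : L) (i : ι) : PolyOn V fun z => A z u i := by
  -- Induction on the distance `m` to the bottom of the filtration: bracketing with a frame field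
  -- raises `k` by one, and at `k = N` the field is zero.
  have key : ∀ m k, m + k = N → ∀ w, 𝔰.IsCoparallel V A w → (∀ z ∈ V, w z ∈ F.space k) →
      ∀ u, PolyOn V fun z => 𝔰.om u (w z) := by
    intro m
    induction m with
    | zero =>
      rintro k hk w - hw u
      rw [zero_add] at hk
      subst hk
      exact (polyOn_const 0).congr fun z hz => by rw [F.eq_zero _ (hw z hz), map_zero]
    | succ m ih =>
      intro k hk w hw hwk u
      have hd : ∀ z ∈ V, DifferentiableAt ℝ w z := fun z hz =>
        (hw.diff z hz).differentiableAt (hV.mem_nhds hz)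
      refine hA.polyOn_of_frame hV hV' F
        (fun z hz => ((𝔰.om u).differentiableAt.comp z (hd z hz)).differentiableWithinAt)
        fun j => ?_
      have h1 := ih (k + 1) (by omega) _ ((hA.isCoparallel_frame hV j).bracket hV hw)
        (fun z hz => F.br_mem k _ _ (hwk z hz)) u
      refine ((polyOn_const (-1)).mul h1).congr fun z hz => ?_
      have h2 := ((𝔰.om u).hasFDerivAt.comp z (hd z hz).hasFDerivAt).fderiv
      have h3 : (fun z => 𝔰.om u (w z)) = 𝔰.om u ∘ w := rfl
      rw [h3, h2, ContinuousLinearMap.comp_apply, hw.fderiv_apply z hz, map_neg, neg_one_mul]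
  exact (key N 0 (add_zero N) _ (hA.isCoparallel_frame hV i) (fun z _ => F.mem_zero _) u).congr
    fun z _ => (𝔰.om_frame A i z u).symm

end SymplecticAlgebra.IsParallel

end SymplecticLie

end

/-! ### The symplectic Lie algebra of the group, carried on the normed model space. -/

noncomputable section

namespace SymplecticLie

variable {n : ℕ} {G : Type*} [TopologicalSpace G] [ChartedSpace (EuclideanSpace ℝ (Fin n)) G]
  [Group G]

section Algebra

namespace NondegCocycle

/-- The inverse of `v ↦ Ω · v`. -/
def modelSharp (Ω : NondegCocycle n G) :
    (EuclideanSpace ℝ (Fin n) →L[ℝ] ℝ) →L[ℝ] EuclideanSpace ℝ (Fin n) :=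
  haveI : FiniteDimensional ℝ (GroupLieAlgebra (𝓡 n) G) :=
    inferInstanceAs (FiniteDimensional ℝ (EuclideanSpace ℝ (Fin n)))
  LinearMap.toContinuousLinearMap
    -- The sign appears because `toDual` represents `l` by the first argument of the form, while
    -- here the representing vector sits in the second.
    { toFun := fun l => -(Ω.form.toDual Ω.nondeg).symm (l : EuclideanSpace ℝ (Fin n) →ₗ[ℝ] ℝ)
      map_add' := fun l m => by
        have := map_add (Ω.form.toDual Ω.nondeg).symm
          (l : EuclideanSpace ℝ (Fin n) →ₗ[ℝ] ℝ) (m : EuclideanSpace ℝ (Fin n) →ₗ[ℝ] ℝ)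
        exact (congrArg Neg.neg this).trans (neg_add _ _)
      map_smul' := fun c l => by
        have := map_smul (Ω.form.toDual Ω.nondeg).symm c
          (l : EuclideanSpace ℝ (Fin n) →ₗ[ℝ] ℝ)
        exact (congrArg Neg.neg this).trans (smul_neg _ _).symm }

theorem form_modelSharp (Ω : NondegCocycle n G) (l : EuclideanSpace ℝ (Fin n) →L[ℝ] ℝ)
    (u : GroupLieAlgebra (𝓡 n) G) : Ω.form u (Ω.modelSharp l) = l u := by
  have : FiniteDimensional ℝ (GroupLieAlgebra (𝓡 n) G) :=
    inferInstanceAs (FiniteDimensional ℝ (EuclideanSpace ℝ (Fin n)))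
  have h := LinearMap.BilinForm.apply_toDual_symm_apply (hB := Ω.nondeg)
    (l : EuclideanSpace ℝ (Fin n) →ₗ[ℝ] ℝ) u
  have h2 : Ω.form u ((Ω.form.toDual Ω.nondeg).symm (l : EuclideanSpace ℝ (Fin n) →ₗ[ℝ] ℝ)) =
      -l u := by
    rw [← Ω.alt.neg_eq]
    exact congrArg Neg.neg h
  exact (map_neg (Ω.form u) _).trans (by rw [h2, neg_neg])

end NondegCocycle

variable [LieGroup (𝓡 n) ∞ G]

variable (n G) in
/-- The Lie bracket of `T_1 G`, on the model space. -/
def modelBracket : EuclideanSpace ℝ (Fin n) →L[ℝ] EuclideanSpace ℝ (Fin n) →L[ℝ]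
    EuclideanSpace ℝ (Fin n) :=
  LinearMap.toContinuousBilinearMap <| LinearMap.mk₂ ℝ
    (Bracket.bracket : GroupLieAlgebra (𝓡 n) G → GroupLieAlgebra (𝓡 n) G → GroupLieAlgebra (𝓡 n) G)
    (fun u v w => add_lie (L := GroupLieAlgebra (𝓡 n) G) (M := GroupLieAlgebra (𝓡 n) G) u v w)
    (fun c u v => smul_lie (R := ℝ) (L := GroupLieAlgebra (𝓡 n) G)
      (M := GroupLieAlgebra (𝓡 n) G) c u v)
    (fun u v w => lie_add (L := GroupLieAlgebra (𝓡 n) G) (M := GroupLieAlgebra (𝓡 n) G) u v w)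
    (fun c u v => lie_smul (R := ℝ) (L := GroupLieAlgebra (𝓡 n) G)
      (M := GroupLieAlgebra (𝓡 n) G) c u v)

namespace NondegCocycle

/-- The nondegenerate cocycle, on the model space. -/
def modelForm (Ω : NondegCocycle n G) : EuclideanSpace ℝ (Fin n) →L[ℝ]
    EuclideanSpace ℝ (Fin n) →L[ℝ] ℝ :=
  LinearMap.toContinuousBilinearMap <| LinearMap.mk₂ ℝ
    (fun u v => Ω.form (u : GroupLieAlgebra (𝓡 n) G) (v : GroupLieAlgebra (𝓡 n) G))
    (fun u v w => LinearMap.map_add₂ Ω.form u v w)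
    (fun c u v => LinearMap.map_smul₂ Ω.form c u v)
    (fun u v w => map_add (Ω.form u) v w)
    (fun c u v => map_smul (Ω.form u) c v)

/-- The symplectic Lie algebra of `(G, Ω⁺)`, on the model space. -/
def algebra (Ω : NondegCocycle n G) : SymplecticAlgebra (EuclideanSpace ℝ (Fin n)) where
  br := modelBracket n G
  om := Ω.modelForm
  prod := Ω.prod
  sharp := Ω.modelSharp
  om_sharp l u := Ω.form_modelSharp l u
  om_neg u v := (Ω.alt.neg_eq v u).symm
  ext_om v w h := by
    have h1 : ∀ u : GroupLieAlgebra (𝓡 n) G, Ω.form u (v - w : GroupLieAlgebra (𝓡 n) G) = 0 :=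
      fun u => (map_sub (Ω.form u) v w).trans (sub_eq_zero.2 (h u))
    exact sub_eq_zero.1 (Ω.nondeg.2 _ h1)
  br_neg u v := (lie_skew (L := GroupLieAlgebra (𝓡 n) G) u v).symm
  jacobi u v w := leibniz_lie (L₁ := GroupLieAlgebra (𝓡 n) G) (L₂ := GroupLieAlgebra (𝓡 n) G)
    (M := GroupLieAlgebra (𝓡 n) G) u v w
  cocycle := Ω.cocycle
  om_prod := Ω.form_prod

/-- The lower central series of a nilpotent Lie algebra. -/
theorem exists_flag (Ω : NondegCocycle n G)
    (hnil : LieRing.IsNilpotent (GroupLieAlgebra (𝓡 n) G)) : ∃ N, Nonempty (Ω.algebra.Flag N) := by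
  obtain ⟨N, hN⟩ := (LieModule.isNilpotent_iff ℤ (GroupLieAlgebra (𝓡 n) G)
    (GroupLieAlgebra (𝓡 n) G)).1 hnil
  -- Integer coefficients suffice, since `Flag` only involves the underlying sets.
  let lcs := LieModule.lowerCentralSeries ℤ (GroupLieAlgebra (𝓡 n) G) (GroupLieAlgebra (𝓡 n) G)
  have hbr : ∀ k, ∀ u v : GroupLieAlgebra (𝓡 n) G, v ∈ lcs k → ⁅u, v⁆ ∈ lcs (k + 1) :=
    fun k u v hv => by
      simp only [lcs, LieModule.lowerCentralSeries_succ]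
      exact LieSubmodule.lie_mem_lie (LieSubmodule.mem_top _) hv
  have hzero : ∀ u : GroupLieAlgebra (𝓡 n) G, u ∈ lcs N → u = 0 := fun u hu => by
    rw [show lcs N = ⊥ from hN] at hu
    exact (LieSubmodule.mem_bot _).1 hu
  exact ⟨N, ⟨{
    space := fun k => (lcs k : Set (GroupLieAlgebra (𝓡 n) G))
    mem_zero := fun u => LieSubmodule.mem_top (R := ℤ) (L := GroupLieAlgebra (𝓡 n) G)
      (M := GroupLieAlgebra (𝓡 n) G) u
    br_mem := fun k u v hv => hbr k u v hv
    eq_zero := fun u hu => hzero u hu }⟩⟩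

end NondegCocycle

end Algebra

end SymplecticLie

end

/-! ### Left invariant vector fields in a chart. -/

noncomputable section

namespace SymplecticLie

variable {n : ℕ} {G : Type*} [TopologicalSpace G] [ChartedSpace (EuclideanSpace ℝ (Fin n)) G]
  {x : OpenPartialHomeomorph G (EuclideanSpace ℝ (Fin n))}

theorem mdifferentiable_chart (hx : x ∈ IsManifold.maximalAtlas (𝓡 n) ∞ G) :
    x.MDifferentiable (𝓡 n) (𝓡 n) :=
  ⟨(contMDiffOn_of_mem_maximalAtlas hx).mdifferentiableOn (by simp),
    (contMDiffOn_symm_of_mem_maximalAtlas hx).mdifferentiableOn (by simp)⟩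

theorem isInvertible_mfderiv_chart (hx : x ∈ IsManifold.maximalAtlas (𝓡 n) ∞ G) {g : G}
    (hg : g ∈ x.source) : (mfderiv (𝓡 n) (𝓡 n) x g).IsInvertible :=
  ⟨(mdifferentiable_chart hx).mfderiv hg, rfl⟩

theorem isInvertible_mfderiv_chart_symm (hx : x ∈ IsManifold.maximalAtlas (𝓡 n) ∞ G)
    {z : EuclideanSpace ℝ (Fin n)} (hz : z ∈ x.target) :
    (mfderiv (𝓡 n) (𝓡 n) x.symm z).IsInvertible :=
  ⟨(mdifferentiable_chart hx).symm.mfderiv hz, rfl⟩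

variable [Group G]

-- The field at `g` is the image of the pair (0_g, v) under the tangent map of multiplication, hence
-- a composition of smooth maps.
open Bundle in
theorem contMDiff_mulInvariantVectorField_infty [LieGroup (𝓡 n) ∞ G]
    (v : GroupLieAlgebra (𝓡 n) G) :
    ContMDiff (𝓡 n) (𝓡 n).tangent ∞
      (fun g : G => (mulInvariantVectorField v g : TangentBundle (𝓡 n) G)) := by
  let fg : G → TangentBundle (𝓡 n) G := fun g => TotalSpace.mk' (EuclideanSpace ℝ (Fin n)) g 0
  have sfg : ContMDiff (𝓡 n) (𝓡 n).tangent ∞ fg := contMDiff_zeroSection _ _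
  let fv : G → TangentBundle (𝓡 n) G := fun _ => TotalSpace.mk' (EuclideanSpace ℝ (Fin n)) 1 v
  have sfv : ContMDiff (𝓡 n) (𝓡 n).tangent ∞ fv := contMDiff_const
  let F₁ : G → (TangentBundle (𝓡 n) G × TangentBundle (𝓡 n) G) := fun g => (fg g, fv g)
  have S₁ : ContMDiff (𝓡 n) ((𝓡 n).tangent.prod (𝓡 n).tangent) ∞ F₁ := sfg.prodMk sfv
  let F₂ : (TangentBundle (𝓡 n) G × TangentBundle (𝓡 n) G) →
      TangentBundle ((𝓡 n).prod (𝓡 n)) (G × G) := (equivTangentBundleProd (𝓡 n) G (𝓡 n) G).symm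
  have S₂ : ContMDiff ((𝓡 n).tangent.prod (𝓡 n).tangent) ((𝓡 n).prod (𝓡 n)).tangent ∞ F₂ :=
    contMDiff_equivTangentBundleProd_symm
  let F₃ : TangentBundle ((𝓡 n).prod (𝓡 n)) (G × G) → TangentBundle (𝓡 n) G :=
    tangentMap ((𝓡 n).prod (𝓡 n)) (𝓡 n) (fun p : G × G => p.1 * p.2)
  have S₃ : ContMDiff ((𝓡 n).prod (𝓡 n)).tangent (𝓡 n).tangent ∞ F₃ :=
    ContMDiff.contMDiff_tangentMap (contMDiff_mul (𝓡 n) ∞) le_rfl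
  have S := (S₃.comp S₂).comp S₁
  convert! S with g
  · simp [F₁, F₂, F₃, fg, fv]
  · simp only [Function.comp_apply, tangentMap, F₃, F₂, F₁, fg, fv]
    rw [mfderiv_prod_eq_add_apply ((contMDiff_mul (𝓡 n) ∞).mdifferentiableAt (by simp))]
    change mfderiv (𝓡 n) (𝓡 n) (g * ·) 1 v =
      mfderiv (𝓡 n) (𝓡 n) (· * (1 : G)) g 0 + mfderiv (𝓡 n) (𝓡 n) (g * ·) 1 v
    exact ((congrArg (· + _) (map_zero _)).trans (zero_add _)).symm

/-- The map giving the left invariant fields at `g` in the chart `x`. -/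
def chartFrame (x : OpenPartialHomeomorph G (EuclideanSpace ℝ (Fin n))) (g : G) :
    EuclideanSpace ℝ (Fin n) →L[ℝ] EuclideanSpace ℝ (Fin n) :=
  ContinuousLinearMap.comp
    (mfderiv (𝓡 n) (𝓡 n) x g : EuclideanSpace ℝ (Fin n) →L[ℝ] EuclideanSpace ℝ (Fin n))
    (mfderiv (𝓡 n) (𝓡 n) (g * ·) (1 : G) :
      EuclideanSpace ℝ (Fin n) →L[ℝ] EuclideanSpace ℝ (Fin n))

/-- The map giving the left invariant fields in the coordinates of the chart `x`. -/
def chartField (x : OpenPartialHomeomorph G (EuclideanSpace ℝ (Fin n)))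
    (z : EuclideanSpace ℝ (Fin n)) : EuclideanSpace ℝ (Fin n) →L[ℝ] EuclideanSpace ℝ (Fin n) :=
  chartFrame x (x.symm z)

theorem chartField_chart {g : G} (hg : g ∈ x.source) : chartField x (x g) = chartFrame x g := by
  rw [chartField, x.left_inv hg]

variable [LieGroup (𝓡 n) ∞ G]

theorem isInvertible_of_injective {f : EuclideanSpace ℝ (Fin n) →L[ℝ] EuclideanSpace ℝ (Fin n)}
    (hf : Function.Injective f) : f.IsInvertible :=
  ⟨(LinearEquiv.ofInjectiveEndo (f : EuclideanSpace ℝ (Fin n) →ₗ[ℝ] EuclideanSpace ℝ (Fin n))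
    hf).toContinuousLinearEquiv, by ext; rfl⟩

/-- `leftTriv g` undoes this map, which is therefore injective; the dimension is finite. -/
theorem isInvertible_mfderiv_mul_left (g : G) :
    (mfderiv (𝓡 n) (𝓡 n) (g * ·) (1 : G)).IsInvertible := by
  refine isInvertible_of_injective fun u v h => ?_
  have h' := congrArg (leftTriv g) h
  exact (leftTriv_mulInvariantVectorField u g).symm.trans
    (h'.trans (leftTriv_mulInvariantVectorField v g))

theorem isInvertible_chartField (hx : x ∈ IsManifold.maximalAtlas (𝓡 n) ∞ G)
    {z : EuclideanSpace ℝ (Fin n)} (hz : z ∈ x.target) : (chartField x z).IsInvertible :=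
  (isInvertible_mfderiv_chart hx (x.map_target hz)).comp (isInvertible_mfderiv_mul_left _)

-- This identification gives access to the smoothness of pulled back fields and to the naturality of
-- their Lie bracket.
omit [LieGroup (𝓡 n) ∞ G] in
theorem chartField_eq_mpullback (hx : x ∈ IsManifold.maximalAtlas (𝓡 n) ∞ G)
    {z : EuclideanSpace ℝ (Fin n)} (hz : z ∈ x.target) (u : GroupLieAlgebra (𝓡 n) G) :
    chartField x z u =
      VectorField.mpullback (𝓡 n) (𝓡 n) x.symm (mulInvariantVectorField u) z := by
  rw [VectorField.mpullback_apply]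
  refine ((isInvertible_mfderiv_chart_symm hx hz).inverse_apply_eq.2 ?_).symm
  have h := (mdifferentiable_chart hx).symm_comp_deriv (x.map_target hz)
  rw [x.right_inv hz] at h
  exact (DFunLike.congr_fun h _).symm

omit [LieGroup (𝓡 n) ∞ G] in
theorem leftTriv_mfderiv_inverse (hx : x ∈ IsManifold.maximalAtlas (𝓡 n) ∞ G) {g : G}
    (hg : g ∈ x.source) (e : EuclideanSpace ℝ (Fin n)) :
    leftTriv g ((mfderiv (𝓡 n) (𝓡 n) x g).inverse e) = (chartFrame x g).inverse e :=
  (ContinuousLinearMap.IsInvertible.inverse_comp_apply_of_left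
    (g := (mfderiv (𝓡 n) (𝓡 n) x g :
      EuclideanSpace ℝ (Fin n) →L[ℝ] EuclideanSpace ℝ (Fin n)))
    (isInvertible_mfderiv_chart hx hg)).symm

theorem contDiffOn_chartField (hx : x ∈ IsManifold.maximalAtlas (𝓡 n) ∞ G) :
    ContDiffOn ℝ ∞ (chartField x) x.target := by
  refine contDiffOn_clm_apply.2 fun u z hz => ?_
  have h := (contMDiff_mulInvariantVectorField_infty (G := G) u).contMDiffAt (x := x.symm z)
  have h1 := ContMDiffAt.mpullback_vectorField_preimage h
    (contMDiffAt_symm_of_mem_maximalAtlas hx hz) (isInvertible_mfderiv_chart_symm hx hz)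
    (by simp)
  have h2 := contMDiffAt_vectorSpace_iff_contDiffAt.1 h1
  refine (h2.congr_of_eventuallyEq ?_).contDiffWithinAt
  filter_upwards [x.open_target.mem_nhds hz] with y hy using chartField_eq_mpullback hx hy u

theorem mlieBracket_model (V W : Π z : EuclideanSpace ℝ (Fin n), TangentSpace (𝓡 n) z) :
    VectorField.mlieBracket (𝓡 n) V W = VectorField.lieBracket ℝ V W :=
  VectorField.mlieBracketWithin_univ.symm.trans
    (VectorField.mlieBracketWithin_eq_lieBracketWithin.trans VectorField.lieBracketWithin_univ)

/-- The left side is the coordinate formula for the bracket of `u⁺` and `v⁺`, and brackets commute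
with pullback by `x.symm`. -/
theorem lieBracket_chartField (hx : x ∈ IsManifold.maximalAtlas (𝓡 n) ∞ G)
    {z : EuclideanSpace ℝ (Fin n)} (hz : z ∈ x.target) (u v : EuclideanSpace ℝ (Fin n)) :
    fderiv ℝ (chartField x) z (chartField x z u) v -
      fderiv ℝ (chartField x) z (chartField x z v) u = chartField x z (modelBracket n G u v) := by
  have hd : DifferentiableAt ℝ (chartField x) z :=
    ((contDiffOn_chartField hx).contDiffAt (x.open_target.mem_nhds hz)).differentiableAt (by simp)
  have h := VectorField.mpullback_mlieBracket (n := ∞)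
    (mdifferentiableAt_mulInvariantVectorField (I := 𝓡 n) (G := G) u (g := x.symm z))
    (mdifferentiableAt_mulInvariantVectorField (I := 𝓡 n) (G := G) v (g := x.symm z))
    (contMDiffAt_symm_of_mem_maximalAtlas hx hz)
    (by rw [minSmoothness_of_isRCLikeNormedField]; exact ENat.LEInfty.out)
  have hb : mulInvariantVectorField (I := 𝓡 n) (G := G) (modelBracket n G u v) = _ :=
    (mulInvariantVector_mlieBracket u v)
  have h1 : chartField x z (modelBracket n G u v) = _ :=
    (chartField_eq_mpullback hx hz _).trans
      ((congrArg (fun W => VectorField.mpullback (𝓡 n) (𝓡 n) x.symm W z) hb).trans h)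
  have he : ∀ w : EuclideanSpace ℝ (Fin n),
      VectorField.mpullback (𝓡 n) (𝓡 n) x.symm (mulInvariantVectorField w) =ᶠ[nhds z]
        (fun y => chartField x y w) := fun w => by
    filter_upwards [x.open_target.mem_nhds hz] with y hy
      using (chartField_eq_mpullback hx hy w).symm
  have h2 := h1.trans ((he u).mlieBracket_vectorField_eq (he v))
  have h3 := congrFun (mlieBracket_model (fun y => chartField x y u)
    (fun y => chartField x y v)) z
  have h4 : ∀ w : EuclideanSpace ℝ (Fin n), ∀ a, fderiv ℝ (fun y => chartField x y w) z a =
      fderiv ℝ (chartField x) z a w := fun w a => by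
    rw [(hd.hasFDerivAt.clm_apply (hasFDerivAt_const w z)).fderiv]
    simp
  refine Eq.symm ((h2.trans h3).trans ?_)
  exact congrArg₂ (· - ·) (h4 v _) (h4 u _)

end SymplecticLie

end

/-! ### The connection in a chart: affine charts are those in which the left invariant frame is
parallel. -/

noncomputable section

namespace SymplecticLie

variable {n : ℕ} {G : Type*} [TopologicalSpace G] [ChartedSpace (EuclideanSpace ℝ (Fin n)) G]
  [Group G] [LieGroup (𝓡 n) ∞ G] {x : OpenPartialHomeomorph G (EuclideanSpace ℝ (Fin n))}

theorem exists_mulInvariantVectorField_eq (g : G) (X : TangentSpace (𝓡 n) g) :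
    ∃ u : GroupLieAlgebra (𝓡 n) G, mulInvariantVectorField u g = X :=
  (isInvertible_mfderiv_mul_left g).surjective X

omit [LieGroup (𝓡 n) ∞ G] in
theorem leftComponents_coordinate (hx : x ∈ IsManifold.maximalAtlas (𝓡 n) ∞ G) {g : G}
    (hg : g ∈ x.source) (e : EuclideanSpace ℝ (Fin n)) :
    leftComponents (VectorField.mpullback (𝓡 n) (𝓡 n) x (fun _ => e)) g =
      (chartField x (x g)).inverse e :=
  (leftTriv_mfderiv_inverse hx hg e).trans (by rw [chartField_chart hg])

theorem differentiableAt_chartField (hx : x ∈ IsManifold.maximalAtlas (𝓡 n) ∞ G)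
    {z : EuclideanSpace ℝ (Fin n)} (hz : z ∈ x.target) :
    DifferentiableAt ℝ (chartField x) z :=
  ((contDiffOn_chartField hx).contDiffAt (x.open_target.mem_nhds hz)).differentiableAt (by simp)

theorem differentiableAt_chartField_inverse (hx : x ∈ IsManifold.maximalAtlas (𝓡 n) ∞ G)
    {z : EuclideanSpace ℝ (Fin n)} (hz : z ∈ x.target) :
    DifferentiableAt ℝ (fun z => (chartField x z).inverse) z :=
  ((isInvertible_chartField hx hz).contDiffAt_map_inverse (n := 1)).differentiableAt
    one_ne_zero |>.comp z (differentiableAt_chartField hx hz)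

/-- Obtained by differentiating the constant function `A y ((A y).inverse e) = e`. -/
theorem fderiv_inverse_apply {A : EuclideanSpace ℝ (Fin n) →
      EuclideanSpace ℝ (Fin n) →L[ℝ] EuclideanSpace ℝ (Fin n)}
    {z : EuclideanSpace ℝ (Fin n)} (hA : DifferentiableAt ℝ A z)
    (hinv : ∀ᶠ y in nhds z, (A y).IsInvertible) (a e : EuclideanSpace ℝ (Fin n)) :
    A z (fderiv ℝ (fun y => (A y).inverse) z a e) =
      -fderiv ℝ A z a ((A z).inverse e) := by
  have hd : DifferentiableAt ℝ (fun y => (A y).inverse) z :=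
    (hinv.self_of_nhds.contDiffAt_map_inverse (n := 1)).differentiableAt
      one_ne_zero |>.comp z hA
  have h := (hA.hasFDerivAt.clm_apply
    (hd.hasFDerivAt.clm_apply (hasFDerivAt_const e z))).fderiv
  have h1 : (fun y => A y ((A y).inverse e)) =ᶠ[nhds z] fun _ => e := by
    filter_upwards [hinv] with y hy using hy.self_apply_inverse e
  rw [h1.fderiv_eq] at h
  have h2 := DFunLike.congr_fun h a
  simp at h2
  rw [eq_neg_iff_add_eq_zero]
  exact h2.symm

/-- The left components of the constant coordinate field `e` are `(chartField x z).inverse e`; the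
two terms are their derivative and the Christoffel term. -/
theorem NondegCocycle.nabla_coordinate (Ω : NondegCocycle n G)
    (hx : x ∈ IsManifold.maximalAtlas (𝓡 n) ∞ G) {g : G} (hg : g ∈ x.source)
    (e : EuclideanSpace ℝ (Fin n)) (u : GroupLieAlgebra (𝓡 n) G) :
    Ω.nabla (VectorField.mpullback (𝓡 n) (𝓡 n) x (fun _ => e)) g (mulInvariantVectorField u g) =
      mulInvariantVectorField (show GroupLieAlgebra (𝓡 n) G from
        fderiv ℝ (fun z => (chartField x z).inverse) (x g) (chartField x (x g) u) e +
          Ω.algebra.prod u ((chartField x (x g)).inverse e)) g := by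
  have hz := x.map_source hg
  have h1 : (mvfderiv (𝓡 n) (leftComponents
      (VectorField.mpullback (𝓡 n) (𝓡 n) x (fun _ => e))) g
        (mulInvariantVectorField u g) : EuclideanSpace ℝ (Fin n)) =
      fderiv ℝ (fun z => (chartField x z).inverse) (x g) (chartField x (x g) u) e := by
    have hd : HasFDerivAt (fun z => (chartField x z).inverse e)
        ((fderiv ℝ (fun z => (chartField x z).inverse) (x g)).flip e) (x g) := by
      simpa using (differentiableAt_chartField_inverse hx hz).hasFDerivAt.clm_apply
        (hasFDerivAt_const e _)
    have hc := (hd.hasMFDerivAt.comp g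
      ((mdifferentiable_chart hx).mdifferentiableAt hg).hasMFDerivAt)
    have hev : leftComponents (VectorField.mpullback (𝓡 n) (𝓡 n) x (fun _ => e)) =ᶠ[nhds g]
        (fun z => (chartField x z).inverse e) ∘ x := by
      filter_upwards [x.open_source.mem_nhds hg] with h hh using leftComponents_coordinate hx hh e
    have hm := (hc.congr_of_eventuallyEq hev).mfderiv
    refine (DFunLike.congr_fun hm (mulInvariantVectorField u g)).trans ?_
    rw [chartField_chart hg]
    rfl
  have h2 : leftTriv g (VectorField.mpullback (𝓡 n) (𝓡 n) x (fun _ => e) g) =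
      (chartField x (x g)).inverse e := leftComponents_coordinate hx hg e
  rw [NondegCocycle.nabla, leftTriv_mulInvariantVectorField, h2]
  exact congrArg (fun d : GroupLieAlgebra (𝓡 n) G => mulInvariantVectorField (I := 𝓡 n)
    (d + Ω.prod u ((chartField x (x g)).inverse e)) g) h1

/-- The left multiplication by `u`. -/
def SymplecticAlgebra.leftMul {L : Type*} [NormedAddCommGroup L] [NormedSpace ℝ L]
    (𝔰 : SymplecticAlgebra L) (u : L) : L →ₗ[ℝ] L where
  toFun := 𝔰.prod u
  map_add' v w := 𝔰.ext_om _ _ fun a => by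
    rw [𝔰.om_neg, 𝔰.om_prod, map_add, map_add, add_apply, 𝔰.om_neg a (𝔰.prod u v),
      𝔰.om_neg a (𝔰.prod u w), 𝔰.om_prod, 𝔰.om_prod]
    ring
  map_smul' c v := 𝔰.ext_om _ _ fun a => by
    rw [𝔰.om_neg, 𝔰.om_prod, map_smul, map_smul, smul_apply, 𝔰.om_neg a (𝔰.prod u v),
      𝔰.om_prod]
    simp

/-- The chart `x` is affine if and only if the left invariant fields satisfy the equations
of a parallel frame in the chart. -/
theorem NondegCocycle.parallel_iff (Ω : NondegCocycle n G)
    (hx : x ∈ IsManifold.maximalAtlas (𝓡 n) ∞ G) :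
    (∀ i : Fin n, ∀ g ∈ x.source, ∀ X : TangentSpace (𝓡 n) g,
      Ω.nabla (VectorField.mpullback (𝓡 n) (𝓡 n) x
        (fun _ => (EuclideanSpace.single i 1 : EuclideanSpace ℝ (Fin n)))) g X = 0) ↔
    Ω.algebra.IsParallel x.target (chartField x) := by
  have hA : ∀ z ∈ x.target, ∀ a e, chartField x z
      (fderiv ℝ (fun y => (chartField x y).inverse) z a e) =
        -fderiv ℝ (chartField x) z a ((chartField x z).inverse e) := fun z hz a e =>
    fderiv_inverse_apply (differentiableAt_chartField hx hz)
      (by filter_upwards [x.open_target.mem_nhds hz] with y hy using isInvertible_chartField hx hy)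
      a e
  -- The equation for `A` is rewritten as one for its inverse, whose columns are the left components
  -- of the fields ∂/∂xᵢ.
  have hpar : Ω.algebra.IsParallel x.target (chartField x) ↔ ∀ z ∈ x.target, ∀ u e,
      fderiv ℝ (fun y => (chartField x y).inverse) z (chartField x z u) e +
        Ω.algebra.leftMul u ((chartField x z).inverse e) = 0 := by
    constructor
    · intro h z hz u e
      have h1 := hA z hz (chartField x z u) e
      rw [h.fderiv_apply z hz, ← map_neg] at h1
      rw [(isInvertible_chartField hx hz).injective h1]
      exact neg_add_cancel _
    · intro h
      refine ⟨fun z hz => (differentiableAt_chartField hx hz).differentiableWithinAt,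
        fun z hz => isInvertible_chartField hx hz, fun z hz u v => ?_⟩
      have h1 := hA z hz (chartField x z u) (chartField x z v)
      rw [eq_neg_of_add_eq_zero_left (h z hz u _),
        (isInvertible_chartField hx hz).inverse_apply_self, map_neg, neg_inj] at h1
      exact h1.symm
  rw [hpar]
  constructor
  · intro h z hz u
    have h1 : ∀ i : Fin n, fderiv ℝ (fun y => (chartField x y).inverse) z (chartField x z u)
        (EuclideanSpace.single i 1) + Ω.algebra.leftMul u
          ((chartField x z).inverse (EuclideanSpace.single i 1)) = 0 := fun i => by
      have h2 := (Ω.nabla_coordinate hx (x.map_target hz) _ u).symm.trans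
        (h i _ (x.map_target hz) _)
      rw [x.right_inv hz] at h2
      exact (isInvertible_mfderiv_mul_left (x.symm z)).injective
        (h2.trans (map_zero (mfderiv (𝓡 n) (𝓡 n) (x.symm z * ·) (1 : G))).symm)
    intro e
    rw [euclidean_sum_single e]
    simp only [map_sum, map_smul, ← Finset.sum_add_distrib, ← smul_add, h1, smul_zero,
      Finset.sum_const_zero]
  · intro h i g hg X
    obtain ⟨u, rfl⟩ := exists_mulInvariantVectorField_eq g X
    refine (Ω.nabla_coordinate hx hg _ u).trans ?_
    exact (congrArg (mfderiv (𝓡 n) (𝓡 n) (g * ·) (1 : G)) (h _ (x.map_source hg) u _)).trans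
      (map_zero (mfderiv (𝓡 n) (𝓡 n) (g * ·) (1 : G)))

end SymplecticLie

end

/-! ### Left invariant multivectors and brackets of polynomial functions. -/

noncomputable section

namespace SymplecticLie

variable {n : ℕ} {G : Type*} [TopologicalSpace G]
  {x : OpenPartialHomeomorph G (EuclideanSpace ℝ (Fin n))}

theorem PolyOn.isPolynomialIn {F : EuclideanSpace ℝ (Fin n) → ℝ} (hF : PolyOn x.target F)
    {f : G → ℝ} (h : ∀ g ∈ x.source, f g = F (x g)) : IsPolynomialIn x f := by
  obtain ⟨p, hp⟩ := hF
  exact ⟨p, fun g hg => (h g hg).trans (hp _ (x.map_source hg))⟩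

theorem IsPolynomialIn.polyOn {f : G → ℝ} (hf : IsPolynomialIn x f) :
    PolyOn x.target (f ∘ x.symm) := by
  obtain ⟨p, hp⟩ := hf
  exact ⟨p, fun z hz => by simp [hp _ (x.map_target hz), x.right_inv hz]⟩

variable [ChartedSpace (EuclideanSpace ℝ (Fin n)) G]

theorem mvfderiv_comp_chart (hx : x ∈ IsManifold.maximalAtlas (𝓡 n) ∞ G) {g : G}
    (hg : g ∈ x.source) {F : EuclideanSpace ℝ (Fin n) → ℝ} {F' : EuclideanSpace ℝ (Fin n) →L[ℝ] ℝ}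
    (hF : HasFDerivAt F F' (x g)) {f : G → ℝ} (hf : ∀ h ∈ x.source, f h = F (x h))
    (X : TangentSpace (𝓡 n) g) :
    mvfderiv (𝓡 n) f g X = F' (mfderiv (𝓡 n) (𝓡 n) x g X) := by
  have hc := (hF.hasMFDerivAt.comp g
    ((mdifferentiable_chart hx).mdifferentiableAt hg).hasMFDerivAt)
  have hev : f =ᶠ[nhds g] F ∘ x := by
    filter_upwards [x.open_source.mem_nhds hg] with h hh using hf h hh
  exact DFunLike.congr_fun (hc.congr_of_eventuallyEq hev).mfderiv X

theorem mvfderiv_coordinate (hx : x ∈ IsManifold.maximalAtlas (𝓡 n) ∞ G) {g : G}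
    (hg : g ∈ x.source) (i : Fin n) (X : TangentSpace (𝓡 n) g) :
    mvfderiv (𝓡 n) (fun h => x h i) g X =
      (EuclideanSpace.proj i : EuclideanSpace ℝ (Fin n) →L[ℝ] ℝ) (mfderiv (𝓡 n) (𝓡 n) x g X) :=
  mvfderiv_comp_chart (F := fun z => z i)
    (F' := (EuclideanSpace.proj i : EuclideanSpace ℝ (Fin n) →L[ℝ] ℝ)) hx hg
    (EuclideanSpace.proj i : EuclideanSpace ℝ (Fin n) →L[ℝ] ℝ).hasFDerivAt (fun _ _ => rfl) X

theorem clm_eq_sum_proj (l : EuclideanSpace ℝ (Fin n) →L[ℝ] ℝ) :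
    l = ∑ r, l (EuclideanSpace.single r 1) •
      (EuclideanSpace.proj r : EuclideanSpace ℝ (Fin n) →L[ℝ] ℝ) := by
  ext v
  rw [clm_apply_eq_sum]
  simp [mul_comm]

theorem alternating_apply_eq_sum {k : ℕ}
    (T : (EuclideanSpace ℝ (Fin n) →L[ℝ] ℝ) [⋀^Fin k]→ₗ[ℝ] ℝ)
    (l : Fin k → EuclideanSpace ℝ (Fin n) →L[ℝ] ℝ) :
    T l = ∑ r : Fin k → Fin n, (∏ j, l j (EuclideanSpace.single (r j) 1)) *
      T fun j => (EuclideanSpace.proj (r j) : EuclideanSpace ℝ (Fin n) →L[ℝ] ℝ) := by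
  conv_lhs => rw [funext fun j => clm_eq_sum_proj (l j)]
  rw [← AlternatingMap.coe_multilinearMap, MultilinearMap.map_sum]
  refine Finset.sum_congr rfl fun r _ => ?_
  rw [MultilinearMap.map_smul_univ, smul_eq_mul]

variable [Group G]

/-- Translating to the unit replaces `dxᵢ` at `g` by the `i`-th row of `chartFrame x g`, and leaves
the constant tensor `T 1`. -/
theorem leftInvariant_coefficient {k : ℕ} {T : MultivectorField n G k}
    (hT : IsLeftInvariant T) (hx : x ∈ IsManifold.maximalAtlas (𝓡 n) ∞ G) {g : G}
    (hg : g ∈ x.source) (i : Fin k → Fin n) :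
    T g (fun j => mvfderiv (𝓡 n) (fun h : G => x h (i j)) g) =
      (T 1 : (EuclideanSpace ℝ (Fin n) →L[ℝ] ℝ) [⋀^Fin k]→ₗ[ℝ] ℝ) fun j =>
        (EuclideanSpace.proj (i j) : EuclideanSpace ℝ (Fin n) →L[ℝ] ℝ).comp (chartFrame x g) := by
  -- Invariance speaks of the fibre at `g * 1`, which equals `g` only propositionally.
  have h1 := congrArg (fun g => T g (fun j => mvfderiv (𝓡 n) (fun h : G => x h (i j)) g))
    (mul_one g)
  refine h1.symm.trans ((hT g 1 _).trans ?_)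
  refine congrArg (T 1 : (EuclideanSpace ℝ (Fin n) →L[ℝ] ℝ) [⋀^Fin k]→ₗ[ℝ] ℝ) (funext fun j => ?_)
  have h2 : ∀ g', g' = g → ∀ X : EuclideanSpace ℝ (Fin n),
      mvfderiv (𝓡 n) (fun h => x h (i j)) g' X =
        (EuclideanSpace.proj (i j) : EuclideanSpace ℝ (Fin n) →L[ℝ] ℝ)
          (mfderiv (𝓡 n) (𝓡 n) x g X) := by
    rintro _ rfl X
    exact mvfderiv_coordinate hx hg (i j) X
  exact ContinuousLinearMap.ext fun u => h2 (g * 1) (mul_one g) _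

variable [LieGroup (𝓡 n) ∞ G]

theorem NondegCocycle.IsAffineChart.polyOn_chartField {Ω : NondegCocycle n G}
    (hnil : LieRing.IsNilpotent (GroupLieAlgebra (𝓡 n) G)) (hx : Ω.IsAffineChart x)
    (u : EuclideanSpace ℝ (Fin n)) (i : Fin n) :
    PolyOn x.target fun z => chartField x z u i := by
  obtain ⟨N, ⟨F⟩⟩ := Ω.exists_flag hnil
  refine ((Ω.parallel_iff hx.smooth).1 hx.parallel).polyOn_apply x.open_target ?_ F u i
  rw [← x.image_source_eq_target]
  exact hx.connected.image _ x.continuousOn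

/-- Expanding `T 1` multilinearly writes each coefficient as a combination, with constant
coefficients, of products of coordinates of left invariant fields. -/
theorem NondegCocycle.isPolynomial_of_isLeftInvariant (Ω : NondegCocycle n G)
    (hnil : LieRing.IsNilpotent (GroupLieAlgebra (𝓡 n) G)) {k : ℕ} {T : MultivectorField n G k}
    (hT : IsLeftInvariant T) : Ω.IsPolynomial T := by
  intro x hx i
  refine PolyOn.isPolynomialIn (F := fun z => ∑ r : Fin k → Fin n,
    (∏ j, chartField x z (EuclideanSpace.single (r j) 1) (i j)) *
      (T 1 : (EuclideanSpace ℝ (Fin n) →L[ℝ] ℝ) [⋀^Fin k]→ₗ[ℝ] ℝ) fun j =>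
        (EuclideanSpace.proj (r j) : EuclideanSpace ℝ (Fin n) →L[ℝ] ℝ))
    (PolyOn.sum fun r _ => (PolyOn.prod fun j _ => hx.polyOn_chartField hnil _ _).mul
      (polyOn_const _)) fun g hg => ?_
  refine (leftInvariant_coefficient hT hx.smooth hg i).trans
    ((alternating_apply_eq_sum _ _).trans ?_)
  rw [chartField_chart hg]
  rfl

/-- By the chain rule {f, h} = ∑ ∂ᵣp · ∂ₛq · π(dxᵣ, dxₛ), with `p` and `q` the polynomials of `f`
and `h`. -/
theorem NondegCocycle.IsPolynomial.isPolynomialPoisson {Ω : NondegCocycle n G}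
    {π : MultivectorField n G 2} (hπ : Ω.IsPolynomial π) : Ω.IsPolynomialPoisson π := by
  rintro x hx f h ⟨p, hp⟩ ⟨q, hq⟩
  have key : ∀ g ∈ x.source, bracket π f h g = ∑ r : Fin 2 → Fin n,
      (∏ j, MvPolynomial.eval (fun i => x g i) (MvPolynomial.pderiv (r j) (![p, q] j))) *
        π g fun j => mvfderiv (𝓡 n) (fun h : G => x h (r j)) g := by
    intro g hg
    have hd : ∀ (f : G → ℝ) (p : MvPolynomial (Fin n) ℝ),
        (∀ g ∈ x.source, f g = MvPolynomial.eval (fun i => x g i) p) →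
        mvfderiv (𝓡 n) f g = ∑ r, MvPolynomial.eval (fun i => x g i) (MvPolynomial.pderiv r p) •
          mvfderiv (𝓡 n) (fun h : G => x h r) g := by
      intro f p hp
      ext X
      rw [mvfderiv_comp_chart hx.smooth hg (hasFDerivAt_eval p (x g)) hp]
      simp only [sum_apply, smul_apply, mvfderiv_coordinate hx.smooth hg]
      have hsum : ∀ (c : Fin n → ℝ) (Y : EuclideanSpace ℝ (Fin n)),
          (∑ r, c r • (EuclideanSpace.proj r : EuclideanSpace ℝ (Fin n) →L[ℝ] ℝ)) Y =
            ∑ r, c r • (EuclideanSpace.proj r : EuclideanSpace ℝ (Fin n) →L[ℝ] ℝ) Y := by simp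
      exact hsum _ _
    have hv : ![mvfderiv (𝓡 n) f g, mvfderiv (𝓡 n) h g] = fun j : Fin 2 =>
        ∑ r, MvPolynomial.eval (fun i => x g i) (MvPolynomial.pderiv r (![p, q] j)) •
          mvfderiv (𝓡 n) (fun h : G => x h r) g := by
      funext j
      fin_cases j
      · exact hd f p hp
      · exact hd h q hq
    rw [bracket, hv, ← AlternatingMap.coe_multilinearMap, MultilinearMap.map_sum]
    refine Finset.sum_congr rfl fun r _ => ?_
    rw [MultilinearMap.map_smul_univ, smul_eq_mul]
  refine PolyOn.isPolynomialIn (F := fun z => ∑ r : Fin 2 → Fin n,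
      (∏ j, MvPolynomial.eval (fun i => z i) (MvPolynomial.pderiv (r j) (![p, q] j))) *
        ((fun g => π g fun j => mvfderiv (𝓡 n) (fun h : G => x h (r j)) g) ∘ x.symm) z)
    (PolyOn.sum fun r _ => (PolyOn.prod fun j _ => ⟨_, fun _ _ => rfl⟩).mul (hπ x hx r).polyOn)
    fun g hg => ?_
  rw [key g hg]
  refine Finset.sum_congr rfl fun r _ => congrArg (_ * ·) ?_
  exact (congrArg (fun g => π g fun j => mvfderiv (𝓡 n) (fun h : G => x h (r j)) g)
    (x.left_inv hg)).symm

end SymplecticLie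

end

/-! ### Multiplication in charts, right invariant fields and their commutation with left invariant
ones. -/

noncomputable section

namespace SymplecticLie

variable {n : ℕ} {G : Type*} [TopologicalSpace G] [ChartedSpace (EuclideanSpace ℝ (Fin n)) G]
  [Group G] [LieGroup (𝓡 n) ∞ G] {φ ψ : OpenPartialHomeomorph G (EuclideanSpace ℝ (Fin n))}

/-- A chain rule for base points that agree only propositionally, such as `g * 1` and `g`. -/
theorem hasMFDerivAt_comp_of_eq {M M' : Type*} [TopologicalSpace M]
    [ChartedSpace (EuclideanSpace ℝ (Fin n)) M] [TopologicalSpace M']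
    [ChartedSpace (EuclideanSpace ℝ (Fin n)) M'] {f : M' → EuclideanSpace ℝ (Fin n)} {h : M → M'}
    {x : M} {y : M'} {f' h' : EuclideanSpace ℝ (Fin n) →L[ℝ] EuclideanSpace ℝ (Fin n)}
    (hf : HasMFDerivAt (𝓡 n) (𝓡 n) f y f') (hh : HasMFDerivAt (𝓡 n) (𝓡 n) h x h')
    (e : h x = y) : HasMFDerivAt (𝓡 n) (𝓡 n) (fun a => f (h a)) x (f'.comp h') := by
  subst e
  exact hf.comp x hh

theorem hasMFDerivAt_chart_mul_left (hφ : φ ∈ IsManifold.maximalAtlas (𝓡 n) ∞ G) {g : G}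
    (hg : g ∈ φ.source) :
    HasMFDerivAt (𝓡 n) (𝓡 n) (fun y : G => φ (g * y)) 1 (chartFrame φ g) := by
  have h1 : MDifferentiableAt (𝓡 n) (𝓡 n) (g * ·) (1 : G) :=
    mdifferentiableAt_of_isInvertible_mfderiv (isInvertible_mfderiv_mul_left g)
  exact hasMFDerivAt_comp_of_eq
    ((mdifferentiable_chart hφ).mdifferentiableAt hg).hasMFDerivAt h1.hasMFDerivAt (mul_one g)

/-- The multiplication of `G`, in the charts `ψ` and `φ`. -/
def chartMul (ψ φ : OpenPartialHomeomorph G (EuclideanSpace ℝ (Fin n)))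
    (p : EuclideanSpace ℝ (Fin n) × EuclideanSpace ℝ (Fin n)) : EuclideanSpace ℝ (Fin n) :=
  φ (ψ.symm p.1 * φ.symm p.2)

/-- The domain of `chartMul`. -/
def chartMulDomain (ψ φ : OpenPartialHomeomorph G (EuclideanSpace ℝ (Fin n))) :
    Set (EuclideanSpace ℝ (Fin n) × EuclideanSpace ℝ (Fin n)) :=
  {p | p.1 ∈ ψ.target ∧ p.2 ∈ φ.target ∧ ψ.symm p.1 * φ.symm p.2 ∈ φ.source}

theorem contDiffAt_chartMul (hψ : ψ ∈ IsManifold.maximalAtlas (𝓡 n) ∞ G)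
    (hφ : φ ∈ IsManifold.maximalAtlas (𝓡 n) ∞ G)
    {p : EuclideanSpace ℝ (Fin n) × EuclideanSpace ℝ (Fin n)} (hp : p ∈ chartMulDomain ψ φ) :
    ContDiffAt ℝ ∞ (chartMul ψ φ) p := by
  rw [← contMDiffAt_iff_contDiffAt]
  refine (contMDiffAt_of_mem_maximalAtlas hφ hp.2.2).comp p (ContMDiffAt.mul ?_ ?_)
  · exact (contMDiffAt_symm_of_mem_maximalAtlas hψ hp.1).comp p contDiffAt_fst.contMDiffAt
  · exact (contMDiffAt_symm_of_mem_maximalAtlas hφ hp.2.1).comp p contDiffAt_snd.contMDiffAt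

theorem eventually_mem_chartMulDomain
    {p : EuclideanSpace ℝ (Fin n) × EuclideanSpace ℝ (Fin n)} (hp : p ∈ chartMulDomain ψ φ) :
    ∀ᶠ q in nhds p, q ∈ chartMulDomain ψ φ := by
  have : IsTopologicalGroup G := topologicalGroup_of_lieGroup (𝓡 n) ∞
  have h1 : ContinuousAt (fun p : EuclideanSpace ℝ (Fin n) × EuclideanSpace ℝ (Fin n) =>
      ψ.symm p.1 * φ.symm p.2) p :=
    (ContinuousAt.comp (g := ψ.symm) (ψ.symm.continuousAt hp.1) continuousAt_fst).mul
      (ContinuousAt.comp (g := φ.symm) (φ.symm.continuousAt hp.2.1) continuousAt_snd)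
  exact (continuousAt_fst.eventually_mem (ψ.open_target.mem_nhds hp.1)).and
    ((continuousAt_snd.eventually_mem (φ.open_target.mem_nhds hp.2.1)).and
      (h1.eventually_mem (φ.open_source.mem_nhds hp.2.2)))

/-- Left translation by `ψ.symm a` preserves `u⁺`: both sides are the differential at `y = 1` of `φ
(ψ.symm a * g * y)`, bracketed in two ways. -/
theorem fderiv_chartMul_left_invariant (hψ : ψ ∈ IsManifold.maximalAtlas (𝓡 n) ∞ G)
    (hφ : φ ∈ IsManifold.maximalAtlas (𝓡 n) ∞ G)
    {p : EuclideanSpace ℝ (Fin n) × EuclideanSpace ℝ (Fin n)} (hp : p ∈ chartMulDomain ψ φ)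
    (u : EuclideanSpace ℝ (Fin n)) :
    fderiv ℝ (chartMul ψ φ) p (0, chartField φ p.2 u) = chartField φ (chartMul ψ φ p) u := by
  obtain ⟨a, z⟩ := p
  set g := φ.symm z with hg
  have hgs : g ∈ φ.source := φ.map_target hp.2.1
  have hz : φ g = z := φ.right_inv hp.2.1
  have h1 := hasMFDerivAt_chart_mul_left hφ hgs
  have h2 : HasFDerivAt (fun z => chartMul ψ φ (a, z)) _ z :=
    ((contDiffAt_chartMul hψ hφ hp).differentiableAt (by simp)).hasFDerivAt.comp z
      (hasFDerivAt_prodMk_right a z)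
  have h3 := (hasMFDerivAt_comp_of_eq (h2.hasMFDerivAt) h1 (by simpa using hz))
  have h4 := hasMFDerivAt_chart_mul_left hφ (g := ψ.symm a * g) hp.2.2
  have h5 : (fun y : G => φ (ψ.symm a * g * y)) =ᶠ[nhds 1]
      (fun z => chartMul ψ φ (a, z)) ∘ fun y : G => φ (g * y) := by
    have hc : ContinuousAt (fun y : G => g * y) 1 :=
      (contMDiff_mul_left (I := 𝓡 n) (n := ∞) (a := g)).continuous.continuousAt
    filter_upwards [hc.eventually_mem (φ.open_source.mem_nhds (by simpa using hgs))] with y hy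
    simp [chartMul, φ.left_inv hy, mul_assoc]
  have h6 := hasMFDerivAt_unique h4 (h3.congr_of_eventuallyEq h5)
  have h7 := DFunLike.congr_fun h6 u
  have h8 : chartField φ (chartMul ψ φ (a, z)) = chartFrame φ (ψ.symm a * g) :=
    chartField_chart hp.2.2
  rw [h8]
  exact h7.symm

/-- The right invariant fields, in the chart `φ`. -/
def rightField (ψ φ : OpenPartialHomeomorph G (EuclideanSpace ℝ (Fin n)))
    (z : EuclideanSpace ℝ (Fin n)) : EuclideanSpace ℝ (Fin n) →L[ℝ] EuclideanSpace ℝ (Fin n) :=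
  (fderiv ℝ (chartMul ψ φ) (ψ 1, z)).comp (ContinuousLinearMap.inl ℝ _ _)

omit [ChartedSpace (EuclideanSpace ℝ (Fin n)) G] [LieGroup (𝓡 n) ∞ G] in
theorem mem_chartMulDomain_one (h1 : (1 : G) ∈ ψ.source) {z : EuclideanSpace ℝ (Fin n)}
    (hz : z ∈ φ.target) : (ψ 1, z) ∈ chartMulDomain ψ φ :=
  ⟨ψ.map_source h1, hz, by simpa [ψ.left_inv h1] using φ.map_target hz⟩

omit [ChartedSpace (EuclideanSpace ℝ (Fin n)) G] [LieGroup (𝓡 n) ∞ G] in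
theorem chartMul_one (h1 : (1 : G) ∈ ψ.source) {z : EuclideanSpace ℝ (Fin n)}
    (hz : z ∈ φ.target) : chartMul ψ φ (ψ 1, z) = z := by
  simp [chartMul, ψ.left_inv h1, φ.right_inv hz]

theorem contDiffOn_rightField (hψ : ψ ∈ IsManifold.maximalAtlas (𝓡 n) ∞ G)
    (hφ : φ ∈ IsManifold.maximalAtlas (𝓡 n) ∞ G) (h1 : (1 : G) ∈ ψ.source) :
    ContDiffOn ℝ ∞ (rightField ψ φ) φ.target := by
  intro z hz
  have h := (contDiffAt_chartMul hψ hφ (mem_chartMulDomain_one h1 hz)).fderiv_right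
    (m := ∞) (by simp)
  have h2 : ContDiffAt ℝ ∞ (fun z : EuclideanSpace ℝ (Fin n) => (ψ 1, z)) z :=
    contDiffAt_const.prodMk contDiffAt_id
  exact ((h.comp z h2).clm_comp contDiffAt_const).contDiffWithinAt

/-- Left and right invariant fields commute. -/
theorem fderiv_rightField_comm (hψ : ψ ∈ IsManifold.maximalAtlas (𝓡 n) ∞ G)
    (hφ : φ ∈ IsManifold.maximalAtlas (𝓡 n) ∞ G) (h1 : (1 : G) ∈ ψ.source)
    {z : EuclideanSpace ℝ (Fin n)} (hz : z ∈ φ.target) (u c : EuclideanSpace ℝ (Fin n)) :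
    fderiv ℝ (rightField ψ φ) z (chartField φ z u) c =
      fderiv ℝ (chartField φ) z (rightField ψ φ z c) u := by
  have hp := mem_chartMulDomain_one (φ := φ) h1 hz
  have hF := contDiffAt_chartMul hψ hφ hp
  have hF1 : HasFDerivAt (chartMul ψ φ) _ (ψ 1, z) := (hF.differentiableAt (by simp)).hasFDerivAt
  have hF2 : HasFDerivAt (fderiv ℝ (chartMul ψ φ)) _ (ψ 1, z) :=
    ((hF.fderiv_right (m := ∞) (by simp)).differentiableAt (by simp)).hasFDerivAt
  -- Both sides are the mixed second derivative of the multiplication at `(ψ 1, z)`: the left one by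
  -- definition of `rightField`, the right one by differentiating `fderiv_chartMul_left_invariant`
  -- in the first variable.
  have hsymm := hF.isSymmSndFDerivAt
    (by rw [minSmoothness_of_isRCLikeNormedField]; exact ENat.LEInfty.out)
  have hl : HasFDerivAt (fun a : EuclideanSpace ℝ (Fin n) => (a, z))
      (ContinuousLinearMap.inl ℝ _ _) (ψ 1) := hasFDerivAt_prodMk_left _ _
  have h2 : HasFDerivAt (rightField ψ φ) _ z :=
    (hF2.comp z (hasFDerivAt_prodMk_right (ψ 1) z)).clm_comp
      (hasFDerivAt_const (ContinuousLinearMap.inl ℝ _ _) z)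
  have h3 : fderiv ℝ (rightField ψ φ) z (chartField φ z u) c =
      fderiv ℝ (fderiv ℝ (chartMul ψ φ)) (ψ 1, z) (0, chartField φ z u) (c, 0) := by
    rw [h2.fderiv]
    simp
  have h4 : HasFDerivAt (fun a => fderiv ℝ (chartMul ψ φ) (a, z) (0, chartField φ z u)) _ (ψ 1) :=
    (HasFDerivAt.comp (ψ 1) hF2 hl).clm_apply (hasFDerivAt_const _ _)
  have hd := (differentiableAt_chartField hφ hz).hasFDerivAt
  rw [← chartMul_one h1 hz] at hd
  have h5 : HasFDerivAt (fun a => chartField φ (chartMul ψ φ (a, z)) u) _ (ψ 1) :=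
    (HasFDerivAt.comp (ψ 1) hd (HasFDerivAt.comp (ψ 1) hF1 hl)).clm_apply
      (hasFDerivAt_const u _)
  have h6 : (fun a => fderiv ℝ (chartMul ψ φ) (a, z) (0, chartField φ z u)) =ᶠ[nhds (ψ 1)]
      fun a => chartField φ (chartMul ψ φ (a, z)) u := by
    have hc : ContinuousAt (fun a : EuclideanSpace ℝ (Fin n) => (a, z)) (ψ 1) := by fun_prop
    filter_upwards [hc.eventually (eventually_mem_chartMulDomain hp)] with a ha
      using fderiv_chartMul_left_invariant hψ hφ ha u
  have h7 := DFunLike.congr_fun (h4.unique (h5.congr_of_eventuallyEq h6)) c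
  simp only [chartMul_one h1 hz] at h7
  rw [h3, hsymm.eq]
  simpa [rightField] using h7

/-- Right multiplication by `g⁻¹` undoes right multiplication by `g`, so this differential has a
left inverse. -/
theorem isInvertible_rightField (hψ : ψ ∈ IsManifold.maximalAtlas (𝓡 n) ∞ G)
    (hφ : φ ∈ IsManifold.maximalAtlas (𝓡 n) ∞ G) (h1 : (1 : G) ∈ ψ.source)
    {z : EuclideanSpace ℝ (Fin n)} (hz : z ∈ φ.target) : (rightField ψ φ z).IsInvertible := by
  set g := φ.symm z with hg
  have hp := mem_chartMulDomain_one (φ := φ) h1 hz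
  have hl : HasFDerivAt (fun a : EuclideanSpace ℝ (Fin n) => (a, z))
      (ContinuousLinearMap.inl ℝ _ _) (ψ 1) := hasFDerivAt_prodMk_left _ _
  have hF1 : HasFDerivAt (fun a => chartMul ψ φ (a, z)) (rightField ψ φ z) (ψ 1) :=
    HasFDerivAt.comp (g := chartMul ψ φ) (ψ 1)
      ((contDiffAt_chartMul hψ hφ hp).differentiableAt (by simp)).hasFDerivAt hl
  have hK : ContDiffAt ℝ ∞ (fun b => ψ (φ.symm b * g⁻¹)) z := by
    rw [← contMDiffAt_iff_contDiffAt]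
    refine ContMDiffAt.comp (g := ψ) z (contMDiffAt_of_mem_maximalAtlas hψ (by simpa [hg] using h1))
      (ContMDiffAt.mul (contMDiffAt_symm_of_mem_maximalAtlas hφ hz) contMDiffAt_const)
  have hK1 := (hK.differentiableAt (by simp)).hasFDerivAt
  rw [← chartMul_one h1 hz] at hK1
  have h2 := hK1.comp (ψ 1) hF1
  have h3 : (fun b => ψ (φ.symm b * g⁻¹)) ∘ (fun a => chartMul ψ φ (a, z)) =ᶠ[nhds (ψ 1)] id := by
    have hc : ContinuousAt (fun a : EuclideanSpace ℝ (Fin n) => (a, z)) (ψ 1) := by fun_prop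
    filter_upwards [hc.eventually (eventually_mem_chartMulDomain hp)] with a ha
    have h4 : φ.symm (φ (ψ.symm a * g)) = ψ.symm a * g := φ.left_inv ha.2.2
    simp [chartMul, ← hg, h4, ψ.right_inv ha.1]
  have h4 := (h2.congr_of_eventuallyEq h3.symm).unique (hasFDerivAt_id _)
  refine isInvertible_of_injective fun c d hcd => ?_
  have h5 := fun c => DFunLike.congr_fun h4 c
  simp only [ContinuousLinearMap.comp_apply, ContinuousLinearMap.id_apply] at h5
  rw [← h5 c, ← h5 d, hcd]

end SymplecticLie

end

/-! ### Existence of affine charts. -/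

noncomputable section

namespace SymplecticLie

variable {n : ℕ}

theorem contDiffOn_inverse {A : EuclideanSpace ℝ (Fin n) →
      EuclideanSpace ℝ (Fin n) →L[ℝ] EuclideanSpace ℝ (Fin n)} {V : Set (EuclideanSpace ℝ (Fin n))}
    (hA : ContDiffOn ℝ ∞ A V) (hinv : ∀ z ∈ V, (A z).IsInvertible) :
    ContDiffOn ℝ ∞ (fun z => (A z).inverse) V := fun z hz =>
  ((hinv z hz).contDiffAt_map_inverse (n := ∞)).comp_contDiffWithinAt z (hA z hz)

variable (𝔰 : SymplecticAlgebra (EuclideanSpace ℝ (Fin n)))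

/-- The connection is torsion free: paired with `w`, this is the cocycle identity. -/
theorem SymplecticAlgebra.prod_sub_prod (u v : EuclideanSpace ℝ (Fin n)) :
    𝔰.prod u v - 𝔰.prod v u = 𝔰.br u v := by
  refine 𝔰.ext_om _ _ fun w => ?_
  have h1 := 𝔰.cocycle u v w
  rw [map_sub, 𝔰.om_neg w, 𝔰.om_neg w (𝔰.prod v u), 𝔰.om_prod, 𝔰.om_prod]
  rw [𝔰.om_neg (𝔰.br u v), 𝔰.om_neg (𝔰.br v w), 𝔰.br_neg w u, map_neg, neg_apply,
    𝔰.om_neg (𝔰.br u w)] at h1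
  linarith

/-- A frame `A` on an open set, with the structure constants of the Lie algebra, together with
a frame `ρ` commuting with it. -/
structure SymplecticAlgebra.CommutingFrames (V : Set (EuclideanSpace ℝ (Fin n)))
    (A ρ : EuclideanSpace ℝ (Fin n) → EuclideanSpace ℝ (Fin n) →L[ℝ] EuclideanSpace ℝ (Fin n)) :
    Prop where
  isOpen : IsOpen V
  smooth : ContDiffOn ℝ ∞ A V
  smooth_right : ContDiffOn ℝ ∞ ρ V
  invertible : ∀ z ∈ V, (A z).IsInvertible
  invertible_right : ∀ z ∈ V, (ρ z).IsInvertible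
  lieBracket : ∀ z ∈ V, ∀ u v,
    fderiv ℝ A z (A z u) v - fderiv ℝ A z (A z v) u = A z (𝔰.br u v)
  comm : ∀ z ∈ V, ∀ u c, fderiv ℝ ρ z (A z u) c = fderiv ℝ A z (ρ z c) u

namespace SymplecticAlgebra

/-- The fields of the frame `ρ` in the frame `A`. -/
def adField (A ρ : EuclideanSpace ℝ (Fin n) → EuclideanSpace ℝ (Fin n) →L[ℝ]
    EuclideanSpace ℝ (Fin n)) (z : EuclideanSpace ℝ (Fin n)) :
    EuclideanSpace ℝ (Fin n) →L[ℝ] EuclideanSpace ℝ (Fin n) :=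
  (A z).inverse.comp (ρ z)

/-- The 1-forms `om (·, ρ eᵢ)`, in the left trivialization. -/
def omField (A ρ : EuclideanSpace ℝ (Fin n) → EuclideanSpace ℝ (Fin n) →L[ℝ]
    EuclideanSpace ℝ (Fin n)) (z : EuclideanSpace ℝ (Fin n)) :
    EuclideanSpace ℝ (Fin n) →L[ℝ] EuclideanSpace ℝ (Fin n) :=
  ((EuclideanSpace.equiv (Fin n) ℝ).symm : (Fin n → ℝ) →L[ℝ] EuclideanSpace ℝ (Fin n)).comp
    (ContinuousLinearMap.pi fun i => 𝔰.om.flip (adField A ρ z (EuclideanSpace.single i 1)))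

/-- The 1-forms `om (·, ρ eᵢ)`. -/
def omForm (A ρ : EuclideanSpace ℝ (Fin n) → EuclideanSpace ℝ (Fin n) →L[ℝ]
    EuclideanSpace ℝ (Fin n)) (z : EuclideanSpace ℝ (Fin n)) :
    EuclideanSpace ℝ (Fin n) →L[ℝ] EuclideanSpace ℝ (Fin n) :=
  (𝔰.omField A ρ z).comp (A z).inverse

theorem omField_apply (A ρ : EuclideanSpace ℝ (Fin n) → EuclideanSpace ℝ (Fin n) →L[ℝ]
    EuclideanSpace ℝ (Fin n)) (z u : EuclideanSpace ℝ (Fin n)) (i : Fin n) :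
    𝔰.omField A ρ z u i = 𝔰.om u (adField A ρ z (EuclideanSpace.single i 1)) := rfl

end SymplecticAlgebra

namespace SymplecticAlgebra.CommutingFrames

variable {𝔰} {V : Set (EuclideanSpace ℝ (Fin n))} {A ρ : EuclideanSpace ℝ (Fin n) →
  EuclideanSpace ℝ (Fin n) →L[ℝ] EuclideanSpace ℝ (Fin n)} (h : 𝔰.CommutingFrames V A ρ)
  {z : EuclideanSpace ℝ (Fin n)} (hz : z ∈ V)
include h

theorem contDiffOn_adField : ContDiffOn ℝ ∞ (adField A ρ) V :=
  (contDiffOn_inverse h.smooth h.invertible).clm_comp h.smooth_right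

theorem contDiffOn_omField : ContDiffOn ℝ ∞ (𝔰.omField A ρ) V := by
  refine contDiffOn_clm_apply.2 fun u => contDiffOn_euclidean.2 fun i => ?_
  exact (𝔰.om u).contDiff.comp_contDiffOn
    (h.contDiffOn_adField.clm_apply contDiffOn_const)

theorem contDiffOn_omForm : ContDiffOn ℝ ∞ (𝔰.omForm A ρ) V :=
  h.contDiffOn_omField.clm_comp (contDiffOn_inverse h.smooth h.invertible)

include hz

theorem hasFDerivAt_of_contDiffOn {B : EuclideanSpace ℝ (Fin n) →
      EuclideanSpace ℝ (Fin n) →L[ℝ] EuclideanSpace ℝ (Fin n)} (hB : ContDiffOn ℝ ∞ B V) :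
    HasFDerivAt B (fderiv ℝ B z) z :=
  ((hB.contDiffAt (h.isOpen.mem_nhds hz)).differentiableAt (by simp)).hasFDerivAt

/-- Differentiate `A (adField c) = ρ c` along `A u`: commutation rewrites the derivative of `ρ`, and
the structure equation of `A` turns the remaining difference into a bracket. -/
theorem fderiv_adField (u c : EuclideanSpace ℝ (Fin n)) :
    fderiv ℝ (adField A ρ) z (A z u) c = -𝔰.br u (adField A ρ z c) := by
  have h1 := ((h.hasFDerivAt_of_contDiffOn hz h.smooth).clm_apply
    ((h.hasFDerivAt_of_contDiffOn hz h.contDiffOn_adField).clm_apply (hasFDerivAt_const c z)))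
  have h2 := (h.hasFDerivAt_of_contDiffOn hz h.smooth_right).clm_apply (hasFDerivAt_const c z)
  have hR : ∀ y ∈ V, A y (adField A ρ y c) = ρ y c := fun y hy =>
    (h.invertible y hy).self_apply_inverse _
  have h3 : (fun y => ρ y c) =ᶠ[nhds z] fun y => A y (adField A ρ y c) := by
    filter_upwards [h.isOpen.mem_nhds hz] with y hy using (hR y hy).symm
  have h4 := DFunLike.congr_fun (h1.unique (h2.congr_of_eventuallyEq h3.symm)) (A z u)
  have h5 := h.lieBracket z hz u (adField A ρ z c)
  have h6 := h.comm z hz u c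
  rw [hR z hz] at h5
  simp at h4
  refine (h.invertible z hz).injective ?_
  rw [map_neg, ← h5, ← h6, ← h4]
  abel

theorem fderiv_omField (u v : EuclideanSpace ℝ (Fin n)) :
    fderiv ℝ (𝔰.omField A ρ) z (A z u) v = 𝔰.omField A ρ z (𝔰.prod u v) := by
  ext i
  have h1 := ((EuclideanSpace.proj i : EuclideanSpace ℝ (Fin n) →L[ℝ] ℝ).hasFDerivAt.comp z
    ((h.hasFDerivAt_of_contDiffOn hz h.contDiffOn_omField).clm_apply (hasFDerivAt_const v z)))
  have h2 := (𝔰.om v).hasFDerivAt.comp z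
    ((h.hasFDerivAt_of_contDiffOn hz h.contDiffOn_adField).clm_apply
      (hasFDerivAt_const (EuclideanSpace.single i 1) z))
  have h3 := DFunLike.congr_fun (h1.unique h2) (A z u)
  simp at h3
  rw [h3, h.fderiv_adField hz, omField_apply, 𝔰.om_prod, map_neg]

theorem isInvertible_adField : (adField A ρ z).IsInvertible :=
  (h.invertible z hz).inverse.comp (h.invertible_right z hz)

/-- A vector is determined by its ω-pairings with the images of the `eᵢ` under `adField`, which is
onto. -/
theorem isInvertible_omField : (𝔰.omField A ρ z).IsInvertible := by
  refine isInvertible_of_injective fun u v huv => 𝔰.ext_om _ _ fun w => ?_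
  obtain ⟨c, rfl⟩ := (h.isInvertible_adField hz).surjective w
  rw [𝔰.om_neg _ u, 𝔰.om_neg _ v, euclidean_sum_single c]
  simp only [map_sum, map_smul, ← 𝔰.omField_apply, huv]

theorem isInvertible_omForm : (𝔰.omForm A ρ z).IsInvertible :=
  (h.isInvertible_omField hz).comp (h.invertible z hz).inverse

theorem omForm_apply (u : EuclideanSpace ℝ (Fin n)) :
    𝔰.omForm A ρ z (A z u) = 𝔰.omField A ρ z u :=
  congrArg (𝔰.omField A ρ z) ((h.invertible z hz).inverse_apply_self u)

/-- The forms are closed, being parallel for a torsion free connection: `key` expresses parallelism,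
and antisymmetrizing it leaves only the bracket terms, which cancel. -/
theorem fderiv_omForm_symm (a b : EuclideanSpace ℝ (Fin n)) :
    fderiv ℝ (𝔰.omForm A ρ) z a b = fderiv ℝ (𝔰.omForm A ρ) z b a := by
  obtain ⟨u, rfl⟩ := (h.invertible z hz).surjective a
  obtain ⟨v, rfl⟩ := (h.invertible z hz).surjective b
  have key : ∀ u v, fderiv ℝ (𝔰.omForm A ρ) z (A z u) (A z v) +
      𝔰.omForm A ρ z (fderiv ℝ A z (A z u) v) = 𝔰.omField A ρ z (𝔰.prod u v) := by
    intro u v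
    have h1 := (h.hasFDerivAt_of_contDiffOn hz h.contDiffOn_omForm).clm_apply
      ((h.hasFDerivAt_of_contDiffOn hz h.smooth).clm_apply (hasFDerivAt_const v z))
    have h2 := (h.hasFDerivAt_of_contDiffOn hz h.contDiffOn_omField).clm_apply
      (hasFDerivAt_const v z)
    have h3 : (fun y => 𝔰.omField A ρ y v) =ᶠ[nhds z] fun y => 𝔰.omForm A ρ y (A y v) := by
      filter_upwards [h.isOpen.mem_nhds hz] with y hy using (h.omForm_apply hy v).symm
    have h4 := DFunLike.congr_fun (h1.unique (h2.congr_of_eventuallyEq h3.symm)) (A z u)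
    simp at h4
    rw [← h.fderiv_omField hz, ← h4, add_comm]
  have h1 : 𝔰.omForm A ρ z (fderiv ℝ A z (A z u) v) - 𝔰.omForm A ρ z (fderiv ℝ A z (A z v) u) =
      𝔰.omField A ρ z (𝔰.prod u v) - 𝔰.omField A ρ z (𝔰.prod v u) := by
    rw [← map_sub, ← map_sub, h.lieBracket z hz, h.omForm_apply hz, 𝔰.prod_sub_prod]
  rw [← key, ← key] at h1
  have h2 := sub_eq_zero.2 h1
  rw [← sub_eq_zero, ← neg_eq_zero, ← h2]
  abel

/-- The primitives of the forms `om (·, ρ eᵢ)` are the coordinates of a chart in which the frame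
`A` is parallel. -/
theorem exists_parallel_chart :
    ∃ Y : OpenPartialHomeomorph (EuclideanSpace ℝ (Fin n)) (EuclideanSpace ℝ (Fin n)),
      z ∈ Y.source ∧ Y.source ⊆ V ∧ IsPreconnected Y.source ∧ ContDiffOn ℝ ∞ Y Y.source ∧
      ContDiffOn ℝ ∞ Y.symm Y.target ∧
      𝔰.IsParallel Y.target (fun w => (fderiv ℝ Y (Y.symm w)).comp (A (Y.symm w))) := by
  obtain ⟨r, hr, hrV⟩ := Metric.isOpen_iff.1 h.isOpen z hz
  -- Poincaré lemma on a ball, for all the closed forms at once.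
  obtain ⟨X, hX⟩ := (convex_ball z r).exists_forall_hasFDerivAt_of_fderiv_symmetric
    Metric.isOpen_ball
    (fun y hy => (h.hasFDerivAt_of_contDiffOn (hrV hy)
      h.contDiffOn_omForm).differentiableAt.differentiableWithinAt)
    (fun y hy => h.fderiv_omForm_symm (hrV hy))
  have hXs : ContDiffOn ℝ ∞ X (Metric.ball z r) := by
    refine (contDiffOn_infty_iff_fderiv_of_isOpen Metric.isOpen_ball).2
      ⟨fun y hy => (hX y hy).differentiableAt.differentiableWithinAt, ?_⟩
    exact (h.contDiffOn_omForm.mono hrV).congr fun y hy => (hX y hy).fderiv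
  have hXa : ∀ y ∈ Metric.ball z r, ContDiffAt ℝ ∞ X y := fun y hy =>
    hXs.contDiffAt (Metric.isOpen_ball.mem_nhds hy)
  have hinv : ∀ y ∈ Metric.ball z r, ∃ e : EuclideanSpace ℝ (Fin n) ≃L[ℝ]
      EuclideanSpace ℝ (Fin n), HasFDerivAt X (e : EuclideanSpace ℝ (Fin n) →L[ℝ] _) y :=
    fun y hy => by
      obtain ⟨e, he⟩ := h.isInvertible_omForm (hrV hy)
      exact ⟨e, he ▸ hX y hy⟩
  have hzb : z ∈ Metric.ball z r := Metric.mem_ball_self hr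
  obtain ⟨e, he⟩ := hinv z hzb
  set Y0 := (hXa z hzb).toOpenPartialHomeomorph X he (by simp)
  have hz0 : z ∈ Y0.source := (hXa z hzb).mem_toOpenPartialHomeomorph_source he (by simp)
  -- Shrinking the domain of the local inverse to a ball makes it connected.
  obtain ⟨t, ht, htY⟩ := Metric.isOpen_iff.1 (Y0.open_source.inter Metric.isOpen_ball) z
    ⟨hz0, hzb⟩
  let Y := Y0.restrOpen (Metric.ball z t) Metric.isOpen_ball
  have hYX : ∀ y, Y y = X y := fun y => rfl
  have hYs : Y.source = Metric.ball z t :=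
    (Y0.restrOpen_source _ _).trans (Set.inter_eq_right.2 fun y hy => (htY hy).1)
  have hYr : ∀ y ∈ Y.source, y ∈ Metric.ball z r := fun y hy => (htY (hYs ▸ hy)).2
  have hYa : ∀ w ∈ Y.target, ContDiffAt ℝ ∞ Y.symm w := fun w hw => by
    obtain ⟨e, he⟩ := hinv _ (hYr _ (Y.map_target hw))
    exact Y.contDiffAt_symm hw he (hXa _ (hYr _ (Y.map_target hw)))
  -- In the new coordinates the frame `A` has matrix `omField`, whose derivative is already known.
  have hfd : ∀ w ∈ Y.target, (fderiv ℝ Y (Y.symm w)).comp (A (Y.symm w)) =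
      𝔰.omField A ρ (Y.symm w) := fun w hw => by
    have hw' := hYr _ (Y.map_target hw)
    ext1 u
    have h1 : fderiv ℝ Y (Y.symm w) = 𝔰.omForm A ρ (Y.symm w) := (hX _ hw').fderiv
    rw [h1, ContinuousLinearMap.comp_apply, h.omForm_apply (hrV hw')]
  have hD : ∀ w ∈ Y.target, ∀ u, HasFDerivAt
      (fun w => (fderiv ℝ Y (Y.symm w)).comp (A (Y.symm w)))
      ((fderiv ℝ (𝔰.omField A ρ) (Y.symm w)).comp (fderiv ℝ Y.symm w)) w ∧
      fderiv ℝ Y.symm w (𝔰.omField A ρ (Y.symm w) u) = A (Y.symm w) u := by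
    intro w hw u
    have hw' := hYr _ (Y.map_target hw)
    constructor
    · have h1 := HasFDerivAt.comp w
        (h.hasFDerivAt_of_contDiffOn (hrV hw') h.contDiffOn_omField)
        ((hYa w hw).differentiableAt (by simp)).hasFDerivAt
      refine h1.congr_of_eventuallyEq ?_
      filter_upwards [Y.open_target.mem_nhds hw] with y hy using hfd y hy
    · obtain ⟨e, he⟩ := hinv _ hw'
      have h2 : (e : EuclideanSpace ℝ (Fin n) →L[ℝ] _) = 𝔰.omForm A ρ (Y.symm w) :=
        he.unique (hX _ hw')
      rw [(Y.hasFDerivAt_symm hw he).fderiv, ← h.omForm_apply (hrV hw'), ← h2]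
      simp
  refine ⟨Y, hYs ▸ Metric.mem_ball_self ht, fun y hy => hrV (hYr y hy), ?_,
    hXs.mono hYr, fun w hw => (hYa w hw).contDiffWithinAt, ?_, ?_, ?_⟩
  · rw [hYs]
    exact (convex_ball z t).isPreconnected
  · exact fun w hw => (hD w hw 0).1.differentiableAt.differentiableWithinAt
  · intro w hw
    rw [hfd w hw]
    exact h.isInvertible_omField (hrV (hYr _ (Y.map_target hw)))
  · intro w hw u v
    rw [(hD w hw u).1.fderiv, hfd w hw, ContinuousLinearMap.comp_apply, (hD w hw u).2,
      h.fderiv_omField (hrV (hYr _ (Y.map_target hw)))]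

end SymplecticAlgebra.CommutingFrames

section Chart

variable {G : Type*} [TopologicalSpace G] [ChartedSpace (EuclideanSpace ℝ (Fin n)) G]
  [Group G] [LieGroup (𝓡 n) ∞ G] {φ ψ : OpenPartialHomeomorph G (EuclideanSpace ℝ (Fin n))}

theorem NondegCocycle.commutingFrames (Ω : NondegCocycle n G)
    (hψ : ψ ∈ IsManifold.maximalAtlas (𝓡 n) ∞ G)
    (hφ : φ ∈ IsManifold.maximalAtlas (𝓡 n) ∞ G) (h1 : (1 : G) ∈ ψ.source) :
    Ω.algebra.CommutingFrames φ.target (chartField φ) (rightField ψ φ) where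
  isOpen := φ.open_target
  smooth := contDiffOn_chartField hφ
  smooth_right := contDiffOn_rightField hψ hφ h1
  invertible _ hz := isInvertible_chartField hφ hz
  invertible_right _ hz := isInvertible_rightField hψ hφ h1 hz
  lieBracket _ hz := lieBracket_chartField hφ hz
  comm _ hz := fderiv_rightField_comm hψ hφ h1 hz

omit [LieGroup (𝓡 n) ∞ G] in
theorem chartFrame_trans (hφ : φ ∈ IsManifold.maximalAtlas (𝓡 n) ∞ G)
    {Y : OpenPartialHomeomorph (EuclideanSpace ℝ (Fin n)) (EuclideanSpace ℝ (Fin n))} {g : G}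
    (hg : g ∈ φ.source) (hY : DifferentiableAt ℝ Y (φ g)) :
    chartFrame (φ.trans Y) g = (fderiv ℝ Y (φ g)).comp (chartFrame φ g) := by
  have h1 := hasMFDerivAt_comp_of_eq hY.hasFDerivAt.hasMFDerivAt
    ((mdifferentiable_chart hφ).mdifferentiableAt hg).hasMFDerivAt rfl
  have h2 : mfderiv (𝓡 n) (𝓡 n) (φ.trans Y) g = _ := h1.mfderiv
  ext1 u
  exact DFunLike.congr_fun h2 (mfderiv (𝓡 n) (𝓡 n) (g * ·) (1 : G) u)

theorem SymplecticAlgebra.IsParallel.congr {𝔰 : SymplecticAlgebra (EuclideanSpace ℝ (Fin n))}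
    {V : Set (EuclideanSpace ℝ (Fin n))} {A B : EuclideanSpace ℝ (Fin n) →
      EuclideanSpace ℝ (Fin n) →L[ℝ] EuclideanSpace ℝ (Fin n)} (hV : IsOpen V)
    (h : 𝔰.IsParallel V A) (hAB : ∀ z ∈ V, B z = A z) : 𝔰.IsParallel V B where
  diff := h.diff.congr hAB
  invertible z hz := hAB z hz ▸ h.invertible z hz
  fderiv_apply z hz u v := by
    have : B =ᶠ[nhds z] A := by filter_upwards [hV.mem_nhds hz] with y hy using hAB y hy
    rw [this.fderiv_eq, hAB z hz, h.fderiv_apply z hz]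

/-- A chart at `g` is followed by the coordinate change of `exists_parallel_chart`, built from the
right invariant frame; a chart at the unit serves only to define that frame. -/
theorem NondegCocycle.exists_isAffineChart (Ω : NondegCocycle n G) (g : G) :
    ∃ x : OpenPartialHomeomorph G (EuclideanSpace ℝ (Fin n)), Ω.IsAffineChart x ∧ g ∈ x.source := by
  set φ := chartAt (EuclideanSpace ℝ (Fin n)) g
  have hφ : φ ∈ IsManifold.maximalAtlas (𝓡 n) ∞ G := IsManifold.chart_mem_maximalAtlas g
  have hg : g ∈ φ.source := mem_chart_source _ g
  obtain ⟨Y, hgY, hYφ, hYc, hY, hY', hpar⟩ := (Ω.commutingFrames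
    (IsManifold.chart_mem_maximalAtlas (1 : G)) hφ
    (mem_chart_source _ (1 : G))).exists_parallel_chart (φ.map_source hg)
  have hs : (φ.trans Y).source = φ.symm '' Y.source := by
    rw [OpenPartialHomeomorph.trans_source, ← Set.inter_eq_right.2 hYφ,
      φ.symm_image_target_inter_eq]
  have ht : (φ.trans Y).target = Y.target := by
    rw [OpenPartialHomeomorph.trans_target]
    exact Set.inter_eq_left.2 fun w hw => hYφ (Y.map_target hw)
  have hmem : ∀ y ∈ (φ.trans Y).source, y ∈ φ.source ∧ φ y ∈ Y.source := fun y hy => by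
    simpa using hy
  have hx : φ.trans Y ∈ IsManifold.maximalAtlas (𝓡 n) ∞ G := by
    refine (IsManifold.mem_maximalAtlas_iff_contMDiffOn _).2 ⟨?_, ?_⟩
    · exact hY.contMDiffOn.comp ((contMDiffOn_of_mem_maximalAtlas hφ).mono
        fun y hy => (hmem y hy).1) fun y hy => (hmem y hy).2
    · rw [ht]
      exact (contMDiffOn_symm_of_mem_maximalAtlas hφ).comp hY'.contMDiffOn
        fun w hw => hYφ (Y.map_target hw)
  refine ⟨φ.trans Y, ⟨hx, ?_, (Ω.parallel_iff hx).2 ?_⟩, by simpa [hg] using hgY⟩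
  · rw [hs]
    exact hYc.image _ (φ.continuousOn_symm.mono hYφ)
  · refine (ht ▸ hpar).congr (φ.trans Y).open_target fun w hw => ?_
    rw [ht] at hw
    have h1 := hYφ (Y.map_target hw)
    have h2 : φ (φ.symm (Y.symm w)) = Y.symm w := φ.right_inv h1
    have h3 := chartFrame_trans hφ (φ.map_target h1) (Y := Y) (by
      rw [h2]
      exact (hY.contDiffAt (Y.open_source.mem_nhds (Y.map_target hw))).differentiableAt (by simp))
    rw [h2] at h3
    exact h3

end Chart

end SymplecticLie

end

theorem theorem1p2 (n : ℕ) (G : Type*) [TopologicalSpace G]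
    [ChartedSpace (EuclideanSpace ℝ (Fin n)) G] [Group G] [LieGroup (𝓡 n) ∞ G]
    [ConnectedSpace G] (hnil : LieRing.IsNilpotent (GroupLieAlgebra (𝓡 n) G))
    (Ω : SymplecticLie.NondegCocycle n G) :
    (∀ g : G, ∃ x : OpenPartialHomeomorph G (EuclideanSpace ℝ (Fin n)),
      Ω.IsAffineChart x ∧ g ∈ x.source) ∧
    (∀ (k : ℕ) (T : SymplecticLie.MultivectorField n G k),
      SymplecticLie.IsLeftInvariant T → Ω.IsPolynomial T) ∧
    (∀ π : SymplecticLie.MultivectorField n G 2,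
      SymplecticLie.IsLeftInvariant π → SymplecticLie.IsPoisson π →
        Ω.IsPolynomial π ∧ Ω.IsPolynomialPoisson π) := by
  refine ⟨Ω.exists_isAffineChart, fun k T hT => Ω.isPolynomial_of_isLeftInvariant hnil hT,
    fun π hπ _ => ?_⟩
  have h := Ω.isPolynomial_of_isLeftInvariant hnil hπ
  exact ⟨h, h.isPolynomialPoisson⟩
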